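/- Let $G(V,E)$ be a finite connected trivalent planar multigraph with $V\neq\emptyset$ (loops and multiple edges are allowed, each loop contributing $2$ to the degree of its vertex; edges without vertices are not allowed), and let $\Gamma$ be a plane graph for $G$, that is, an embedding of $G$ in the sphere, given by the counterclockwise cyclic order of the half-edges at every vertex. Regard every half-edge as a band with a left and a right strand. A smoothing $\alpha$ assigns $0$ or $1$ to every half-edge: the strands run in parallel if the value is $0$ and cross each other if it is $1$. Next to a vertex, the left strand of each half-edge is joined to the right strand of the next half-edge in counterclockwise order, and in the middle of an edge the left strand of one half is joined to the right strand of the other half. This gives a set of immersed circles, the state of $\alpha$. Let $\widehat V=\mathbb C[x]/(x^n-1)$ with $n=2$, and let $\widehat V_\alpha$ be the tensor product of one copy of $\widehat V$ for each circle of $\alpha$. If $\alpha'$ is obtained from $\alpha$ by changing the value at one half-edge from $0$ to $1$, then, with $m=1$ and exponents read modulo $n$, let $\widehat\partial_{\alpha\alpha'}:\widehat V_\alpha\to\widehat V_{\alpha'}$ be the identity on the factors of the circles that do not pass through the half-edge, and $x^i\otimes x^j\mapsto x^{i+j}$, $x^k\mapsto\sum_{i+j\equiv k+2m}x^i\otimes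 x^j$ (with $0\le i,j<n$), or $x^k\mapsto\sqrt n\,x^{k+m}$ on the remaining ones, according to whether two circles merge, one circle splits, or one circle becomes one circle. A vertex state $\nu\in\{0,1\}^V$ is regarded as the smoothing that takes the value $\nu_v$ at all three half-edges at $v$; put $|\nu|=\sum_v\nu_v$. If $\nu'$ is obtained from $\nu$ by changing $\nu_v$ from $0$ to $1$, let $\widehat\delta_{\nu\nu'}$ be the composition of the three maps $\widehat\partial$ obtained by changing the three half-edges at $v$ one after the other, in any order. Order the vertices, let $\widehat C^i=\bigoplus_{|\nu|=i}\widehat V_\nu$, and let $\widehat\delta:\widehat C^i\to\widehat C^{i+1}$ be the sum of the maps $(-1)^{\#\{u<v\,:\,\nu_u=1\}}\,\widehat\delta_{\nu\nu'}$. Then, for every ordering of the vertices and every choice of the orders in which the half-edges are changed (one order for each $\nu$ and $v$), $\widehat\delta\circ\widehat\delta=0$, and the Euler characteristic of the cohomology $\widehat{VCH}{}_2^{*}(\Gamma)=H^*(\widehat C^*,\widehat\delta)$, the filtered $2$-color vertex homology of $\Gamma$, is $$\chi\big(\widehat{VCH}{}_2^{*}(\Gamma)\big)=\sum_{i=0}^{|V|}(-1)^i\dim_{\mathbb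 C}\widehat{VCH}{}_2^{i}(\Gamma)=2^{\frac12|V|}\cdot\#\{\text{3-edge-colorings of }G\},$$ where a 3-edge-coloring is a map from $E$ to a fixed set of three colors such that distinct half-edges at the same vertex belong to edges of different colors. -/

import Mathlib

/-- A multigraph (loops and multiple edges allowed) with vertex type `V` and half-edge type `D`:
every half-edge `d` is attached to the vertex `vert d`, and the fixed-point-free involution `opp`
pairs the two halves of each edge. -/
structure HalfEdgeGraph (V D : Type*) where
  /-- the vertex that a half-edge is attached to -/
  vert : D → V
  /-- the other half of the same edge -/
  opp : Equiv.Perm D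
  opp_opp : ∀ d, opp (opp d) = d
  opp_ne : ∀ d, opp d ≠ d

namespace HalfEdgeGraph

variable {V D : Type*} (G : HalfEdgeGraph V D)

/-- The edges: pairs `{d, opp d}` of half-edges. -/
def Edge : Type _ := Quotient (Equiv.Perm.SameCycle.setoid G.opp)

/-- The edge that a half-edge belongs to. -/
def edge (d : D) : G.Edge := Quotient.mk (Equiv.Perm.SameCycle.setoid G.opp) d

/-- The half-edges attached to a vertex. -/
abbrev HalfEdgesAt (v : V) : Type _ := {d : D // G.vert d = v}

/-- Exactly three half-edges at every vertex (a loop contributes two of them). -/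
def IsTrivalent : Prop := ∀ v : V, Nat.card (G.HalfEdgesAt v) = 3

/-- Two vertices joined by an edge. -/
def Joined (u w : V) : Prop := ∃ d : D, G.vert d = u ∧ G.vert (G.opp d) = w

/-- There is a vertex, and any two vertices are linked by a path of edges. -/
def IsConnected : Prop := Nonempty V ∧ ∀ u w : V, Relation.ReflTransGen G.Joined u w

/-- The 3-edge-colorings: maps from the edges to a fixed set of three colors such that
different half-edges at the same vertex belong to edges of different colors. (In particular a
graph with a loop has no such coloring.) -/
abbrev ThreeEdgeColoring : Type _ :=
  {c : G.Edge → Fin 3 //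
    ∀ d d' : D, d ≠ d' → G.vert d = G.vert d' → c (G.edge d) ≠ c (G.edge d')}

end HalfEdgeGraph

/-- An oriented ribbon graph, given by a rotation system: a multigraph together with a permutation
`rot` of the half-edges whose cycles are the sets of half-edges at the vertices (isolated vertices
are excluded). It sends a half-edge to the next one, counterclockwise, around its vertex. The
associated closed oriented surface is glued from a disk for every vertex, an untwisted band for
every edge, and a disk for every boundary component of the result. -/
structure RibbonGraph (V D : Type*) extends HalfEdgeGraph V D where
  /-- the next half-edge counterclockwise around the same vertex -/
  rot : Equiv.Perm D
  vert_surjective : Function.Surjective vert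
  vert_eq_iff : ∀ d d', vert d = vert d' ↔ rot.SameCycle d d'

namespace RibbonGraph

variable {V D : Type*} (Γ : RibbonGraph V D)

/-- The faces: the cycles of `rot ∘ opp`, which traverse the boundary components of the ribbon
surface. -/
def Face : Type _ := Quotient (Equiv.Perm.SameCycle.setoid (Γ.rot * Γ.opp))

/-- The Euler characteristic `|V| - |E| + |F|` of the associated closed surface. -/
noncomputable def surfaceEulerChar : ℤ :=
  (Nat.card V : ℤ) - (Nat.card Γ.Edge : ℤ) + (Nat.card Γ.Face : ℤ)

/-- A plane graph: a connected ribbon graph whose closed surface is the sphere. -/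
def IsPlane : Prop := Γ.IsConnected ∧ Γ.surfaceEulerChar = 2

/-! ### States of the bubbled blowup -/

/-- The side points: each half-edge, viewed as a band that leaves its vertex, has a left
(counterclockwise) strand `(d, true)` and a right strand `(d, false)`. The point is the end of the
strand away from the vertex, in the middle of the edge. -/
abbrev SidePoint (_Γ : RibbonGraph V D) : Type _ := D × Bool

/-- A smoothing of each half-edge: the two strands run in parallel (`false`, the 0-smoothing) or
cross each other (`true`, the 1-smoothing). These index the states of the bubbled blowup, whose
perfect matching edges are the half-edges of the graph. -/
abbrev Smoothing (_Γ : RibbonGraph V D) : Type _ := D → Bool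

/-- The elementary arcs of the state `α`. In the middle of an edge the left strand of one half is
the right strand of the other half. Near a vertex, the left strand of `d` continues into the right
strand of `rot d`; following the strands of `d` and of `rot d` outwards, each of them changes side
if the half-edge is crossed. -/
inductive Arc (α : Γ.Smoothing) : Γ.SidePoint → Γ.SidePoint → Prop
  | middle (d : D) (s : Bool) : Arc α (d, s) (Γ.opp d, !s)
  | corner (d : D) : Arc α (d, xor true (α d)) (Γ.rot d, xor false (α (Γ.rot d)))

/-- The immersed circles of the state `α`. -/
def Circle (α : Γ.Smoothing) : Type _ := Quot (Γ.Arc α)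

/-- The circle through a side point. -/
def circle (α : Γ.Smoothing) (p : Γ.SidePoint) : Γ.Circle α := Quot.mk _ p

instance [Finite D] (α : Γ.Smoothing) : Finite (Γ.Circle α) :=
  inferInstanceAs (Finite (Quot (Γ.Arc α)))

/-! ### The vector spaces and the local maps -/

/-- The tensor power `V̂ ^ ⊗ k` of `V̂ = ℂ[x]/(xⁿ - 1)`, with one factor for each of the `k` circles
of the state `α`. A vector is given by its coordinates in the basis of the monomials
`⊗_c x ^ (I c)`, whose exponents `I c` are read modulo `n`. -/
abbrev Space (n : ℕ) (α : Γ.Smoothing) : Type _ := (Γ.Circle α → ZMod n) → ℂ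

open Classical in
/-- The coefficient of the monomial `J` of the state `β` in the image of the monomial `I` of the
state `α`, where `β` is obtained from `α` by changing the smoothing of the half-edge `d` from 0 to
1. With `m = n / 2` (rounded down), circles away from `d` keep their exponents, and the circles
through `d` are changed by
* `x^i ⊗ x^j ↦ x^(i+j)` if two circles are merged into one,
* `x^k ↦ ∑ x^i ⊗ x^j`, over all `i + j ≡ k + 2m` modulo `n`, if one circle is split into two,
* `x^k ↦ √n x^(k+m)` if one circle becomes one circle. -/
noncomputable def edgeCoeff (n : ℕ) (α β : Γ.Smoothing) (d : D)
    (I : Γ.Circle α → ZMod n) (J : Γ.Circle β → ZMod n) : ℂ :=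
  if ∀ p : Γ.SidePoint, Γ.circle α p ≠ Γ.circle α (d, true) →
      Γ.circle α p ≠ Γ.circle α (d, false) → J (Γ.circle β p) = I (Γ.circle α p) then
    if Γ.circle α (d, true) ≠ Γ.circle α (d, false) then
      if J (Γ.circle β (d, true)) = I (Γ.circle α (d, true)) + I (Γ.circle α (d, false))
      then 1 else 0
    else if Γ.circle β (d, true) ≠ Γ.circle β (d, false) then
      if J (Γ.circle β (d, true)) + J (Γ.circle β (d, false)) =
        I (Γ.circle α (d, true)) + ((2 * (n / 2) : ℕ) : ZMod n)
      then 1 else 0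
    else
      if J (Γ.circle β (d, true)) = I (Γ.circle α (d, true)) + ((n / 2 : ℕ) : ZMod n)
      then ((Real.sqrt n : ℝ) : ℂ) else 0
  else 0

/-- The linear map `V̂_α → V̂_β` of the edge `α → β` of the hypercube of states of the bubbled
blowup, where `β` is obtained from `α` by changing the smoothing of `d` from 0 to 1. Its matrix in
the monomial bases is given by `edgeCoeff`. -/
noncomputable def edgeMap [Finite D] (n : ℕ) [NeZero n] (α β : Γ.Smoothing) (d : D) :
    Γ.Space n α →ₗ[ℂ] Γ.Space n β :=
  letI : Fintype (Γ.Circle α → ZMod n) := Fintype.ofFinite _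
  Matrix.mulVecLin (Matrix.of fun J I => Γ.edgeCoeff n α β d I J)

/-! ### Vertex states and the filtered complex -/

/-- The vertex state `ν`, as a state of the bubbled blowup: a vertex 1-smoothing crosses the strands
of all half-edges at the vertex. -/
def vertexSmoothing (ν : V → Bool) : Γ.Smoothing := fun d => ν (Γ.vert d)

/-- A choice, for every edge of the hypercube of vertex states (given by a state `ν` and the vertex
`v` at which the smoothing changes), of one of the six paths of three edges in the hypercube of the
bubbled blowup: the order in which the smoothings of the three half-edges at `v` are changed. -/
abbrev PathChoice : Type _ := (V → Bool) → ∀ v : V, Fin 3 ≃ Γ.HalfEdgesAt v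

/-- The number `|ν|` of vertex 1-smoothings. -/
def weight [Fintype V] (ν : V → Bool) : ℕ := (Finset.univ.filter fun v => ν v = true).card

section Complex

variable [Fintype V] [LinearOrder V] [Finite D] [DecidableEq D]
  (n : ℕ) [NeZero n] (path : Γ.PathChoice)

/-- The map `V̂_ν → V̂_ν'` of an edge of the hypercube of vertex states, where `ν'` is obtained from
`ν` by changing the smoothing at `v` from 0 to 1: the composition of the maps along a path of three
edges in the hypercube of the bubbled blowup. -/
noncomputable def vertexMap (ν ν' : V → Bool) (v : V) :
    Γ.Space n (Γ.vertexSmoothing ν) →ₗ[ℂ] Γ.Space n (Γ.vertexSmoothing ν') :=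
  let d : Fin 3 → D := fun k => (path ν v k : D)
  let α₀ : Γ.Smoothing := Γ.vertexSmoothing ν
  let α₁ : Γ.Smoothing := Function.update α₀ (d 0) true
  let α₂ : Γ.Smoothing := Function.update α₁ (d 1) true
  let α₃ : Γ.Smoothing := Γ.vertexSmoothing ν'
  Γ.edgeMap n α₂ α₃ (d 2) ∘ₗ Γ.edgeMap n α₁ α₂ (d 1) ∘ₗ Γ.edgeMap n α₀ α₁ (d 0)

/-- The chain group in homological degree `i`: the direct sum of the spaces `V̂_ν` over the vertex
states `ν` with `|ν| = i`. -/
abbrev Chain (i : ℕ) : Type _ :=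
  ∀ ν : {ν : V → Bool // weight ν = i}, Γ.Space n (Γ.vertexSmoothing ν.1)

/-- The number of vertices to the left of `v` with a vertex 1-smoothing. -/
def onesBefore (ν : V → Bool) (v : V) : ℕ :=
  (Finset.univ.filter fun u => u < v ∧ ν u = true).card

/-- The filtered differential from degree `i` to degree `i + 1`: the signed sum of the maps of all
edges `ν → ν'` of the hypercube of vertex states. -/
noncomputable def differential (i : ℕ) : Γ.Chain n i →ₗ[ℂ] Γ.Chain n (i + 1) :=
  LinearMap.pi fun ν' => ∑ ν : {ν : V → Bool // weight ν = i}, ∑ v : V,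
    if ν.1 v = false ∧ ν'.1 = Function.update ν.1 v true then
      ((-1 : ℂ) ^ onesBefore ν.1 v) • (Γ.vertexMap n path ν.1 ν'.1 v ∘ₗ LinearMap.proj ν)
    else 0

/-- The cycles in degree `i`. -/
noncomputable def cycles (i : ℕ) : Submodule ℂ (Γ.Chain n i) :=
  LinearMap.ker (Γ.differential n path i)

/-- The boundaries in degree `i`. -/
noncomputable def boundaries : ∀ i : ℕ, Submodule ℂ (Γ.Chain n i)
  | 0 => ⊥
  | i + 1 => LinearMap.range (Γ.differential n path i)

/-- The filtered `n`-color vertex homology group in degree `i`. -/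
abbrev FilteredVertexHomology (i : ℕ) : Type _ :=
  Γ.cycles n path i ⧸ (Γ.boundaries n path i).submoduleOf (Γ.cycles n path i)

/-- The Euler characteristic of the filtered `n`-color vertex homology. The chain groups vanish in
degrees above `|V|`. -/
noncomputable def filteredEulerChar : ℤ :=
  ∑ i ∈ Finset.range (Fintype.card V + 1),
    (-1 : ℤ) ^ i * (Module.finrank ℂ (Γ.FilteredVertexHomology n path i) : ℤ)

end Complex

end RibbonGraph

/-! The Fourier transform on `ZMod 2` diagonalises everything. Pass from monomials to characters, so
that coordinates are indexed by 2-colourings of the circles, that is, by 2-colourings `X` of the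
strands that are constant along arcs. Merging, splitting and the one-to-one map then act by scalars.
After dividing by a weight `√2 · (±1)` for each circle, the scalar of a half-edge depends on `X`
alone and not on the state (`colorFunctional_edgeMap`). Hence the vertex maps commute and do not
depend on the order of their three factors, and the signs give `δ² = 0`.

By Euler–Poincaré the Euler characteristic is `∑ (-1)^|ν| 2^(number of circles of ν)`. Writing the
power of 2 as a number of strand colourings makes this a state sum with one local weight for each
vertex (`sum_vertexStates`). That weight is an alternating 3-tensor on 2×2 matrices. It expands as
half of `levi` in the real Pauli matrices, which are orthogonal under the trace form of an edge. So
`2^|V| χ` is a signed sum over 3-edge-colourings, each counted with absolute value `2^|E|`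
(`sum_prod_vertexWeight`).

Planarity makes every sign `+1`: the edges coloured 0 or 1 form a cycle mod 2, which bounds a set of
faces (`IsPlane.exists_face_coloring`), and the resulting 2-colouring of the faces splits the sign
into local contributions that cancel. With `|V| = 2m` and `|E| = 3m` the remaining factor is `2^(3m)
/ 2^(2m) = 2^m`. -/

section Fourier

/-! ### Fourier analysis on functions of exponents modulo 2. -/

/-- The sign character of `ZMod 2`, with complex values. -/
def zsign (a : ZMod 2) : ℂ := if a = 0 then 1 else -1

lemma zsign_zero : zsign 0 = 1 := by simp [zsign]

lemma zsign_one : zsign 1 = -1 := by simp [zsign]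

lemma zsign_add (a b : ZMod 2) : zsign (a + b) = zsign a * zsign b := by
  have h : ∀ c : ZMod 2, c = 0 ∨ c = 1 := by decide
  have h2 : (1 + 1 : ZMod 2) = 0 := by decide
  rcases h a with rfl | rfl <;> rcases h b with rfl | rfl <;> simp [h2, zsign_zero, zsign_one]

lemma zsign_mul_self (a : ZMod 2) : zsign a * zsign a = 1 := by
  rw [← zsign_add, CharTwo.add_self_eq_zero, zsign_zero]

lemma zsign_ne_zero (a : ZMod 2) : zsign a ≠ 0 := fun h => by
  simpa [h] using zsign_mul_self a

lemma sum_zsign_mul (a : ZMod 2) : ∑ j, zsign (a * j) = if a = 0 then 2 else 0 := by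
  have h : ∀ c : ZMod 2, c = 0 ∨ c = 1 := by decide
  have hu : (Finset.univ : Finset (ZMod 2)) = {0, 1} := by decide
  rw [hu, Finset.sum_pair (by decide)]
  rcases h a with rfl | rfl
  · simp [zsign_zero]; norm_num
  · simp [zsign_zero, zsign_one]

lemma zsign_sum {ι : Type*} (s : Finset ι) (f : ι → ZMod 2) :
    zsign (∑ i ∈ s, f i) = ∏ i ∈ s, zsign (f i) := by
  classical
  induction s using Finset.induction_on with
  | empty => simp [zsign_zero]
  | insert a s ha ih => rw [Finset.sum_insert ha, Finset.prod_insert ha, zsign_add, ih]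

/-- The Fourier coefficient of `f` at `χ`. -/
def zfourier {A : Type*} [Fintype A] [DecidableEq A] (χ : A → ZMod 2) (f : (A → ZMod 2) → ℂ) : ℂ :=
  ∑ I, zsign (∑ a, χ a * I a) * f I

/-- Orthogonality of characters: the sum over `χ` factors over the coordinates, and each coordinate
gives 2 or 0. -/
lemma zfourier_inversion {A : Type*} [Fintype A] [DecidableEq A] (f : (A → ZMod 2) → ℂ) (I : A → ZMod 2) :
    ∑ χ : A → ZMod 2, zsign (∑ a, χ a * I a) * zfourier χ f = 2 ^ Fintype.card A * f I := by
  simp only [zfourier, Finset.mul_sum]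
  rw [Finset.sum_comm]
  have key : ∀ K : A → ZMod 2,
      ∑ χ : A → ZMod 2, zsign (∑ a, χ a * I a) * (zsign (∑ a, χ a * K a) * f K) =
        if K = I then 2 ^ Fintype.card A * f K else 0 := by
    intro K
    have h1 : ∀ χ : A → ZMod 2,
        zsign (∑ a, χ a * I a) * (zsign (∑ a, χ a * K a) * f K) =
          (∏ a, zsign ((I a + K a) * χ a)) * f K := by
      intro χ
      rw [← mul_assoc, ← zsign_add, ← Finset.sum_add_distrib, zsign_sum]
      congr 1
      refine Finset.prod_congr rfl fun a _ => ?_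
      congr 1; ring
    simp only [h1]
    rw [← Finset.sum_mul, ← Fintype.prod_sum (fun a (j : ZMod 2) => zsign ((I a + K a) * j))]
    simp only [sum_zsign_mul]
    split_ifs with h
    · subst h
      simp [CharTwo.add_self_eq_zero]
    · obtain ⟨a, ha⟩ := Function.ne_iff.mp h
      rw [Finset.prod_eq_zero (Finset.mem_univ a), zero_mul]
      rw [if_neg]
      intro h0
      exact ha (CharTwo.add_eq_zero.mp h0).symm
  simp only [key]
  simp

lemma eq_zero_of_zfourier_eq_zero {A : Type*} [Fintype A] [DecidableEq A] (f : (A → ZMod 2) → ℂ) (h : ∀ χ, zfourier χ f = 0) : f = 0 := by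
  funext I
  have := zfourier_inversion f I
  simp only [h, mul_zero, Finset.sum_const_zero] at this
  simpa using this.symm

lemma sum_option_equiv {A B : Type*} [Fintype A] [Fintype B] (e : Option B ≃ A) (F : A → ZMod 2) :
    ∑ a, F a = F (e none) + ∑ b, F (e (some b)) := by
  rw [← e.sum_comp, Fintype.sum_option]

/-- The push-forward of `I` along the map that glues the point `none` to `b₀`. -/
def glue {A B : Type*} [DecidableEq B] (e : Option B ≃ A) (b₀ : B) (I : A → ZMod 2) : B → ZMod 2 :=
  fun b => I (e (some b)) + if b = b₀ then I (e none) else 0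

lemma eq_glue_iff {A B : Type*} [DecidableEq B] (e : Option B ≃ A) (b₀ : B) (I : A → ZMod 2) (J : B → ZMod 2) :
    J = glue e b₀ I ↔
      (∀ b, b ≠ b₀ → J b = I (e (some b))) ∧ J b₀ = I (e (some b₀)) + I (e none) := by
  constructor
  · rintro rfl
    exact ⟨fun b hb => by simp [glue, hb], by simp [glue]⟩
  · rintro ⟨h1, h2⟩
    funext b
    by_cases hb : b = b₀
    · subst hb; simp [glue, h2]
    · simp [glue, hb, h1 b hb]

/-- Merging pushes `f` forward along the homomorphism that adds two exponents, so its transform at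
`χB` is that of `f` at the pulled-back character. -/
lemma zfourier_merge {A B : Type*} [Fintype A] [DecidableEq A] [Fintype B] [DecidableEq B]
    (e : Option B ≃ A) (b₀ : B) (χA : A → ZMod 2) (χB : B → ZMod 2)
    (hχ : ∀ b, χA (e (some b)) = χB b) (h0 : χA (e none) = χB b₀)
    (f : (A → ZMod 2) → ℂ) :
    zfourier χB (fun J => ∑ I, (if J = glue e b₀ I then 1 else 0) * f I) = zfourier χA f := by
  simp only [zfourier, Finset.mul_sum]
  rw [Finset.sum_comm]
  refine Finset.sum_congr rfl fun I _ => ?_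
  rw [Finset.sum_eq_single (glue e b₀ I) (fun J _ hJ => by simp [hJ]) (by simp)]
  simp only [if_true, one_mul]
  congr 2
  rw [sum_option_equiv e]
  simp only [hχ, h0, glue, mul_add, Finset.sum_add_distrib]
  simp [add_comm]

/-- Splitting is the transpose of merging. Summing over the exponent of the extra circle tests
whether the character takes equal values on the two new circles; this gives the factor 2 or 0. -/
lemma zfourier_split {A B : Type*} [Fintype A] [DecidableEq A] [Fintype B] [DecidableEq B]
    (e : Option B ≃ A) (b₀ : B) (χA : A → ZMod 2) (χB : B → ZMod 2)
    (hχ : ∀ b, χA (e (some b)) = χB b) (f : (B → ZMod 2) → ℂ) :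
    zfourier χA (fun I => ∑ J, (if J = glue e b₀ I then 1 else 0) * f J) =
      (if χA (e none) = χB b₀ then 2 else 0) * zfourier χB f := by
  have h1 : zfourier χA (fun I => ∑ J, (if J = glue e b₀ I then 1 else 0) * f J) =
      ∑ I, zsign (∑ a, χA a * I a) * f (glue e b₀ I) := by
    refine Finset.sum_congr rfl fun I _ => ?_
    simp
  rw [h1]
  obtain ⟨E, hE1, hE2⟩ : ∃ E : (A → ZMod 2) ≃ ZMod 2 × (B → ZMod 2),
      (∀ I, (E I).1 = I (e none)) ∧ ∀ I b, (E I).2 b = I (e (some b)) :=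
    ⟨(Equiv.arrowCongr e.symm (Equiv.refl _)).trans
      (Equiv.piOptionEquivProd (β := fun _ => ZMod 2)), fun I => rfl, fun I b => rfl⟩
  let G : ZMod 2 × (B → ZMod 2) → ℂ := fun x => zsign (χA (e none) * x.1) *
    (zsign (∑ b, χB b * x.2 b) * f (x.2 + Pi.single b₀ x.1))
  have h2 : ∀ I, zsign (∑ a, χA a * I a) * f (glue e b₀ I) = G (E I) := by
    intro I
    simp only [G]
    rw [← mul_assoc, ← zsign_add, sum_option_equiv e]
    simp only [hχ, hE1, hE2]
    congr 2
    funext b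
    by_cases hb : b = b₀
    · subst hb; simp [glue, hE2]
    · simp [glue, hE2, hb]
  simp only [h2]
  rw [E.sum_comp G, Fintype.sum_prod_type]
  -- For a fixed exponent `j` of the extra circle, translating the other exponents turns the inner
  -- sum into the transform of `f` times a character of `j`.
  have h3 : ∀ j : ZMod 2, ∑ I' : B → ZMod 2, G (j, I') =
        zsign ((χA (e none) + χB b₀) * j) * zfourier χB f := by
    intro j
    simp only [G]
    rw [← Finset.mul_sum, add_mul, zsign_add, mul_assoc]
    congr 1
    rw [zfourier, Finset.mul_sum]
    refine Fintype.sum_equiv (Equiv.addRight (Pi.single b₀ j : B → ZMod 2)) _ _ fun I' => ?_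
    simp only [Equiv.coe_addRight, Pi.add_apply, mul_add, Finset.sum_add_distrib]
    have : ∑ b, χB b * (Pi.single b₀ j : B → ZMod 2) b = χB b₀ * j := by
      rw [Finset.sum_eq_single b₀ (fun b _ hb => by simp [hb]) (by simp)]; simp
    rw [this, zsign_add]
    linear_combination (-zsign (∑ b, χB b * I' b) *
      f (I' + Pi.single b₀ j)) * zsign_mul_self (χB b₀ * j)
  simp only [h3]
  rw [← Finset.sum_mul, sum_zsign_mul]
  simp only [CharTwo.add_eq_zero]

lemma zfourier_shift {A B : Type*} [Fintype A] [DecidableEq A] [Fintype B] [DecidableEq B]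
    (e : A ≃ B) (b₀ : B) (χA : A → ZMod 2) (χB : B → ZMod 2)
    (hχ : ∀ a, χB (e a) = χA a) (r : ℂ) (f : (A → ZMod 2) → ℂ) :
    zfourier χB (fun J => ∑ I, (if J = I ∘ e.symm + Pi.single b₀ 1 then r else 0) * f I) =
      r * zsign (χB b₀) * zfourier χA f := by
  simp only [zfourier, Finset.mul_sum]
  rw [Finset.sum_comm]
  refine Finset.sum_congr rfl fun I _ => ?_
  rw [Finset.sum_eq_single (I ∘ e.symm + Pi.single b₀ 1) (fun J _ hJ => by simp [hJ]) (by simp)]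
  simp only [if_true, Pi.add_apply, mul_add, Finset.sum_add_distrib, Function.comp_apply, zsign_add]
  have : ∑ b, χB b * (Pi.single b₀ 1 : B → ZMod 2) b = χB b₀ := by
    rw [Finset.sum_eq_single b₀ (fun b _ hb => by simp [hb]) (by simp)]; simp
  rw [this, ← e.sum_comp (fun b => χB b * I (e.symm b))]
  simp only [hχ, Equiv.symm_apply_apply]
  ring

end Fourier

/-! ### Circles of two states that differ at one half-edge. -/

/-- A surjection whose only nontrivial fibre is `{t, f}` is, up to an equivalence, the map from
`Option B` that glues `none` to a point. -/
lemma exists_option_equiv_of_glue {A B : Type*} (π : A → B) (hπ : Function.Surjective π) {t f : A}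
    (htf : t ≠ f) (h : π t = π f)
    (hfib : ∀ a a', π a = π a' → a = a' ∨ ((a = t ∨ a = f) ∧ (a' = t ∨ a' = f))) :
    ∃ e : Option B ≃ A, e none = f ∧ ∀ a, a ≠ f → e (some (π a)) = a := by
  have hs : ∀ b, ∃ a, π a = b ∧ a ≠ f := by
    intro b
    obtain ⟨a, rfl⟩ := hπ b
    by_cases ha : a = f
    · exact ⟨t, by rw [h, ha], htf⟩
    · exact ⟨a, rfl, ha⟩
  -- The section avoids `f`, which is left as the image of `none`.
  choose σ hσ hσf using hs
  have hσπ : ∀ a, a ≠ f → σ (π a) = a := by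
    intro a ha
    rcases hfib _ _ (hσ (π a)) with h1 | ⟨h1 | h1, h2 | h2⟩
    · exact h1
    · rw [h1, h2]
    · exact absurd h2 ha
    · exact absurd h1 (hσf _)
    · exact absurd h2 ha
  let F : Option B → A := fun o => o.elim f σ
  have hF : Function.Bijective F := by
    constructor
    · rintro (_ | b) (_ | b') hb
      · rfl
      · exact absurd hb.symm (hσf b')
      · exact absurd hb (hσf b)
      · have := congrArg π hb
        simp only [F, Option.elim, hσ] at this
        rw [this]
    · intro a
      by_cases ha : a = f
      · exact ⟨none, ha.symm⟩
      · exact ⟨some (π a), hσπ a ha⟩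
  exact ⟨Equiv.ofBijective F hF, rfl, hσπ⟩

namespace RibbonGraph

variable {V D : Type*} {Γ : RibbonGraph V D}

/-- A colouring of the side points that is constant along the arcs of the state `α`. -/
def Compatible (Γ : RibbonGraph V D) {T : Type*} (α : Γ.Smoothing) (X : Γ.SidePoint → T) : Prop :=
  ∀ p q, Γ.Arc α p q → X p = X q

lemma Compatible.eq_of_circle_eq {T : Type*} {α : Γ.Smoothing} {X : Γ.SidePoint → T}
    (h : Γ.Compatible α X) {p q : Γ.SidePoint} (hpq : Γ.circle α p = Γ.circle α q) : X p = X q :=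
  congrArg (Quot.lift X h) hpq

lemma compatible_circle (α : Γ.Smoothing) : Γ.Compatible α (Γ.circle α) :=
  fun _ _ h => Quot.sound h

lemma circle_surjective (α : Γ.Smoothing) : Function.Surjective (Γ.circle α) :=
  Quot.mk_surjective

/-- The states `α` and `β` differ exactly at the half-edge `d`. -/
structure Flip (α β : Γ.Smoothing) (d : D) : Prop where
  eq_of_ne : ∀ d', d' ≠ d → β d' = α d'
  eq_not : β d = !α d

lemma Flip.symm {α β : Γ.Smoothing} {d : D} (h : Flip α β d) : Flip β α d :=
  ⟨fun d' hd => (h.eq_of_ne d' hd).symm, by rw [h.eq_not, Bool.not_not]⟩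

/-- A colouring with the same value on both strands of `d` does not see the smoothing at `d`. -/
lemma Compatible.flip {T : Type*} {α β : Γ.Smoothing} {d : D} (hf : Flip α β d)
    {X : Γ.SidePoint → T} (h : Γ.Compatible α X) (hd : X (d, true) = X (d, false)) :
    Γ.Compatible β X := by
  have hd' : ∀ s s', X (d, s) = X (d, s') := by
    rintro (_ | _) (_ | _) <;> simp [hd]
  have key : ∀ d' b, X (d', xor b (β d')) = X (d', xor b (α d')) := by
    intro d' b
    by_cases hdd : d' = d
    · subst hdd; exact hd' _ _
    · rw [hf.eq_of_ne d' hdd]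
  rintro p q (⟨d', s⟩ | d')
  · exact h _ _ (Arc.middle d' s)
  · rw [key, key]
    exact h _ _ (Arc.corner d')

/-- The two circles through `d`, if they are different, are the only ones that are affected by a
change of the smoothing at `d`. -/
lemma circle_eq_or_of_flip {α β : Γ.Smoothing} {d : D} (hf : Flip α β d) {p q : Γ.SidePoint}
    (h : Γ.circle β p = Γ.circle β q) :
    Γ.circle α p = Γ.circle α q ∨
      ((Γ.circle α p = Γ.circle α (d, true) ∨ Γ.circle α p = Γ.circle α (d, false)) ∧
        (Γ.circle α q = Γ.circle α (d, true) ∨ Γ.circle α q = Γ.circle α (d, false))) := by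
  classical
  let X : Γ.SidePoint → Option (Γ.Circle α) := fun p =>
    if Γ.circle α p = Γ.circle α (d, true) ∨ Γ.circle α p = Γ.circle α (d, false) then none
    else some (Γ.circle α p)
  have hX : Γ.Compatible α X := fun p q hpq => by
    simp only [X, compatible_circle α p q hpq]
  have := (hX.flip hf (by simp [X])).eq_of_circle_eq h
  simp only [X] at this
  split_ifs at this with h1 h2 h2
  · exact Or.inr ⟨h1, h2⟩
  · exact Or.inl (Option.some_injective _ this)

/-- The other end of the corner arc at a side point. -/
def cornerPartner (α : Γ.Smoothing) (p : Γ.SidePoint) : Γ.SidePoint :=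
  if p.2 = !α p.1 then (Γ.rot p.1, α (Γ.rot p.1)) else (Γ.rot.symm p.1, !α (Γ.rot.symm p.1))

lemma cornerPartner_cornerPartner (α : Γ.Smoothing) (p : Γ.SidePoint) :
    cornerPartner α (cornerPartner α p) = p := by
  obtain ⟨d, s⟩ := p
  by_cases h : s = !α d
  · simp [cornerPartner, h]
  · have : s = α d := by simpa using h
    subst this
    simp [cornerPartner]

/-- At the vertex, a corner arc joins a left end to a right end, so its ends differ even where `rot`
has a fixed point. -/
lemma cornerPartner_ne (α : Γ.Smoothing) (p : Γ.SidePoint) : cornerPartner α p ≠ p := by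
  obtain ⟨d, s⟩ := p
  by_cases h : s = !α d
  · simp only [cornerPartner, h, if_true]
    intro h1
    rw [Prod.mk.injEq] at h1
    rw [h1.1] at h1
    simp at h1
  · have hs : s = α d := by simpa using h
    simp only [cornerPartner, hs]
    simp only [Bool.eq_not_self, if_false]
    intro h1
    rw [Prod.mk.injEq] at h1
    rw [h1.1] at h1
    simp at h1

lemma circle_cornerPartner (α : Γ.Smoothing) (p : Γ.SidePoint) :
    Γ.circle α (cornerPartner α p) = Γ.circle α p := by
  obtain ⟨d, s⟩ := p
  by_cases h : s = !α d
  · have := compatible_circle α _ _ (Arc.corner (α := α) d)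
    simp only [cornerPartner, h, if_true]
    simpa using this.symm
  · have hs : s = α d := by simpa using h
    have := compatible_circle α _ _ (Arc.corner (α := α) (Γ.rot.symm d))
    simp only [cornerPartner, hs]
    simpa using this

lemma cornerPartner_flip {α β : Γ.Smoothing} {d : D} (hf : Flip α β d) {p : Γ.SidePoint}
    (h1 : p.1 ≠ d) (h2 : (cornerPartner α p).1 ≠ d) :
    cornerPartner β p = cornerPartner α p := by
  unfold cornerPartner at h2 ⊢
  rw [hf.eq_of_ne _ h1]
  split_ifs at h2 ⊢
  · rw [hf.eq_of_ne _ h2]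
  · rw [hf.eq_of_ne _ h2]

lemma even_card_of_involution {P : Type*} (S : Finset P) (g : P → P)
    (hg : ∀ p ∈ S, g p ∈ S) (hgg : ∀ p, g (g p) = p) (hne : ∀ p, g p ≠ p) :
    ((S.card : ℕ) : ZMod 2) = 0 := by
  have := Finset.sum_involution (s := S) (f := fun _ => (1 : ZMod 2)) (fun p _ => g p)
    (fun p _ => by decide) (fun p _ _ => hne p) hg (fun p _ => hgg p)
  simpa using this

/-- When the smoothing of `d` changes, the two strands of `d` lie on the same circle before or
after the change. -/
lemma circle_eq_or_circle_eq_of_flip [Finite D] {α β : Γ.Smoothing} {d : D} (hf : Flip α β d) :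
    Γ.circle α (d, true) = Γ.circle α (d, false) ∨
      Γ.circle β (d, true) = Γ.circle β (d, false) := by
  classical
  have := Fintype.ofFinite D
  by_contra! hcon
  obtain ⟨hα, hβ⟩ := hcon
  -- Parity argument: the middle arcs pair off the points of `S`, while the corner arcs pair off all
  -- of them except `(d, true)`.
  let S : Finset Γ.SidePoint := Finset.univ.filter fun p =>
    Γ.circle α p = Γ.circle α (d, true) ∧ Γ.circle β p = Γ.circle β (d, true)
  have ht : (d, true) ∈ S := by simp [S]
  have hS : ∀ p, p ∈ S ↔
      Γ.circle α p = Γ.circle α (d, true) ∧ Γ.circle β p = Γ.circle β (d, true) := by simp [S]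
  have e1 : ((S.card : ℕ) : ZMod 2) = 0 := by
    refine even_card_of_involution S (fun p => (Γ.opp p.1, !p.2)) ?_ ?_ ?_
    · rintro ⟨d', s⟩ hp
      rw [hS] at hp ⊢
      rwa [← compatible_circle α _ _ (Arc.middle d' s), ← compatible_circle β _ _ (Arc.middle d' s)]
    · rintro ⟨d', s⟩
      simp [Γ.opp_opp]
    · rintro ⟨d', s⟩ h
      simp at h
  have e2 : (((S.erase (d, true)).card : ℕ) : ZMod 2) = 0 := by
    refine even_card_of_involution _ (cornerPartner α) ?_ (cornerPartner_cornerPartner α)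
      (cornerPartner_ne α)
    intro p hp
    rw [Finset.mem_erase, hS] at hp
    obtain ⟨hpt, hpα, hpβ⟩ := hp
    have hp1 : p.1 ≠ d := by
      obtain ⟨d', s⟩ := p
      rintro rfl
      cases s
      · exact hα hpα.symm
      · exact hpt rfl
    have hct : cornerPartner α p ≠ (d, true) := by
      intro hc
      have hc' : p = cornerPartner α (d, true) := by rw [← hc, cornerPartner_cornerPartner]
      -- Changing the smoothing exchanges the two strands of `d` at the vertex, so `p` would lie on
      -- the `β`-circle of `(d, false)`.
      have : cornerPartner α (d, true) = cornerPartner β (d, false) := by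
        unfold cornerPartner at hc' ⊢
        have hfd := hf.eq_not
        by_cases h : α d = false
        · simp only [h] at hc' hfd ⊢
          simp only [hfd]
          simp at hc' ⊢
          rw [hf.eq_of_ne]
          rintro h3
          exact hp1 (by rw [hc']; exact h3)
        · simp only [Bool.not_eq_false] at h
          simp only [h] at hc' hfd ⊢
          simp only [hfd]
          simp at hc' ⊢
          rw [hf.eq_of_ne]
          rintro h3
          exact hp1 (by rw [hc']; exact h3)
      rw [hc', this, circle_cornerPartner] at hpβ
      exact hβ hpβ.symm
    have hc1 : (cornerPartner α p).1 ≠ d := by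
      intro h
      have hcf : cornerPartner α p = (d, false) := by
        rcases hc : cornerPartner α p with ⟨d', s⟩
        rw [hc] at h hct
        simp only at h
        subst h
        cases s
        · rfl
        · exact absurd rfl hct
      have := circle_cornerPartner α p
      rw [hcf] at this
      exact hα (by rw [this, hpα])
    rw [Finset.mem_erase, hS, circle_cornerPartner]
    refine ⟨hct, hpα, ?_⟩
    rw [← cornerPartner_flip hf hp1 hc1, circle_cornerPartner, hpβ]
  rw [← Finset.card_erase_add_one ht, Nat.cast_add, e2] at e1
  simp at e1

/-- When two circles merge at `d`. -/
lemma exists_equiv_of_merge {α β : Γ.Smoothing} {d : D} (hf : Flip α β d)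
    (hα : Γ.circle α (d, true) ≠ Γ.circle α (d, false))
    (hβ : Γ.circle β (d, true) = Γ.circle β (d, false)) :
    ∃ e : Option (Γ.Circle β) ≃ Γ.Circle α, e none = Γ.circle α (d, false) ∧
      ∀ p, Γ.circle α p ≠ Γ.circle α (d, false) → e (some (Γ.circle β p)) = Γ.circle α p := by
  have hc : Γ.Compatible α (Γ.circle β) := (compatible_circle β).flip hf.symm hβ
  obtain ⟨e, h1, h2⟩ := exists_option_equiv_of_glue (Quot.lift (Γ.circle β) hc)
    (fun b => by obtain ⟨p, rfl⟩ := circle_surjective β b; exact ⟨Γ.circle α p, rfl⟩) hα hβ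
    (fun a a' h => by
      obtain ⟨p, rfl⟩ := circle_surjective α a
      obtain ⟨q, rfl⟩ := circle_surjective α a'
      exact circle_eq_or_of_flip hf h)
  exact ⟨e, h1, fun p hp => h2 _ hp⟩

/-- When the strands of `d` lie on one circle before and after the change. -/
lemma exists_equiv_of_single {α β : Γ.Smoothing} {d : D} (hf : Flip α β d)
    (hα : Γ.circle α (d, true) = Γ.circle α (d, false))
    (hβ : Γ.circle β (d, true) = Γ.circle β (d, false)) :
    ∃ e : Γ.Circle α ≃ Γ.Circle β, ∀ p, e (Γ.circle α p) = Γ.circle β p := by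
  refine ⟨⟨Quot.lift (Γ.circle β) ((compatible_circle β).flip hf.symm hβ),
    Quot.lift (Γ.circle α) ((compatible_circle α).flip hf hα), ?_, ?_⟩, fun p => rfl⟩
  · intro a; obtain ⟨p, rfl⟩ := circle_surjective α a; rfl
  · intro a; obtain ⟨p, rfl⟩ := circle_surjective β a; rfl

end RibbonGraph

/-! ### Diagonalisation of the edge maps. -/

namespace RibbonGraph

variable {V D : Type*} {Γ : RibbonGraph V D}

noncomputable instance [Finite D] (α : Γ.Smoothing) : Fintype (Γ.Circle α) := Fintype.ofFinite _

noncomputable instance (α : Γ.Smoothing) : DecidableEq (Γ.Circle α) := Classical.decEq _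

lemma edgeMap_apply [Finite D] (α β : Γ.Smoothing) (d : D) (f : Γ.Space 2 α)
    (J : Γ.Circle β → ZMod 2) :
    Γ.edgeMap 2 α β d f J = ∑ I, Γ.edgeCoeff 2 α β d I J * f I := by
  simp only [edgeMap, Matrix.mulVecLin_apply, Matrix.mulVec, dotProduct, Matrix.of_apply]
  refine Finset.sum_congr ?_ fun _ _ => rfl
  ext I
  simp

/-- The colour of a circle. -/
noncomputable def circleColor (X : Γ.SidePoint → ZMod 2) (α : Γ.Smoothing) (c : Γ.Circle α) :
    ZMod 2 := X (Quot.out c)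

lemma Compatible.circleColor_circle {α : Γ.Smoothing} {X : Γ.SidePoint → ZMod 2}
    (h : Γ.Compatible α X) (p : Γ.SidePoint) : circleColor X α (Γ.circle α p) = X p :=
  h.eq_of_circle_eq (Quot.out_eq _)

/-- The matrix entries when two circles are merged. -/
lemma edgeCoeff_merge [Finite D] {α β : Γ.Smoothing} {d : D} (hf : Flip α β d)
    (hα : Γ.circle α (d, true) ≠ Γ.circle α (d, false))
    (hβ : Γ.circle β (d, true) = Γ.circle β (d, false))
    (e : Option (Γ.Circle β) ≃ Γ.Circle α) (he : e none = Γ.circle α (d, false))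
    (he' : ∀ p, Γ.circle α p ≠ Γ.circle α (d, false) → e (some (Γ.circle β p)) = Γ.circle α p)
    (I : Γ.Circle α → ZMod 2) (J : Γ.Circle β → ZMod 2) :
    Γ.edgeCoeff 2 α β d I J = if J = glue e (Γ.circle β (d, true)) I then 1 else 0 := by
  have hiff : (∀ p : Γ.SidePoint, Γ.circle α p ≠ Γ.circle α (d, true) →
      Γ.circle α p ≠ Γ.circle α (d, false) → J (Γ.circle β p) = I (Γ.circle α p)) ↔
      ∀ b, b ≠ Γ.circle β (d, true) → J b = I (e (some b)) := by
    constructor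
    · intro h b hb
      obtain ⟨p, rfl⟩ := circle_surjective β b
      have hc : Γ.Compatible α (Γ.circle β) := (compatible_circle β).flip hf.symm hβ
      have h1 : Γ.circle α p ≠ Γ.circle α (d, true) := fun h => hb (hc.eq_of_circle_eq h)
      have h2 : Γ.circle α p ≠ Γ.circle α (d, false) :=
        fun h => hb ((hc.eq_of_circle_eq h).trans hβ.symm)
      rw [h p h1 h2, he' p h2]
    · intro h p h1 h2
      rw [h _ ?_, he' p h2]
      intro h3
      rcases circle_eq_or_of_flip hf h3 with h4 | ⟨h4 | h4, -⟩
      · exact h1 h4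
      · exact h1 h4
      · exact h2 h4
  have ht : e (some (Γ.circle β (d, true))) = Γ.circle α (d, true) := he' _ hα
  simp only [eq_glue_iff, he, ht]
  unfold edgeCoeff
  by_cases h1 : ∀ b, b ≠ Γ.circle β (d, true) → J b = I (e (some b))
  · rw [if_pos (hiff.2 h1), if_pos hα]
    exact if_congr ⟨fun h => ⟨h1, h⟩, fun h => h.2⟩ rfl rfl
  · rw [if_neg fun h => h1 (hiff.1 h), if_neg fun h => h1 h.1]

/-- The matrix entries when a circle is split. -/
lemma edgeCoeff_split [Finite D] {α β : Γ.Smoothing} {d : D} (hf : Flip α β d)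
    (hα : Γ.circle α (d, true) = Γ.circle α (d, false))
    (hβ : Γ.circle β (d, true) ≠ Γ.circle β (d, false))
    (e : Option (Γ.Circle α) ≃ Γ.Circle β) (he : e none = Γ.circle β (d, false))
    (he' : ∀ p, Γ.circle β p ≠ Γ.circle β (d, false) → e (some (Γ.circle α p)) = Γ.circle β p)
    (I : Γ.Circle α → ZMod 2) (J : Γ.Circle β → ZMod 2) :
    Γ.edgeCoeff 2 α β d I J = if I = glue e (Γ.circle α (d, true)) J then 1 else 0 := by
  have hiff : (∀ p : Γ.SidePoint, Γ.circle α p ≠ Γ.circle α (d, true) →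
      Γ.circle α p ≠ Γ.circle α (d, false) → J (Γ.circle β p) = I (Γ.circle α p)) ↔
      ∀ b, b ≠ Γ.circle α (d, true) → I b = J (e (some b)) := by
    have key : ∀ p, Γ.circle α p ≠ Γ.circle α (d, true) →
        e (some (Γ.circle α p)) = Γ.circle β p := by
      intro p hp
      refine he' p fun h => ?_
      rcases circle_eq_or_of_flip hf h with h4 | ⟨h4 | h4, -⟩
      · exact hp (h4.trans hα.symm)
      · exact hp h4
      · exact hp (h4.trans hα.symm)
    constructor
    · intro h b hb
      obtain ⟨p, rfl⟩ := circle_surjective α b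
      rw [key p hb, h p hb (hα ▸ hb)]
    · intro h p h1 h2
      rw [h _ h1, key p h1]
  have ht : e (some (Γ.circle α (d, true))) = Γ.circle β (d, true) := he' _ hβ
  -- For `n = 2` the shift `2m` vanishes modulo `n`, so the split matrix is exactly the transpose of
  -- a merge matrix.
  have h2 : ((2 * (2 / 2) : ℕ) : ZMod 2) = 0 := by decide
  simp only [eq_glue_iff, he, ht]
  unfold edgeCoeff
  by_cases h1 : ∀ b, b ≠ Γ.circle α (d, true) → I b = J (e (some b))
  · rw [if_pos (hiff.2 h1), if_neg (not_not.2 hα), if_pos hβ, h2, add_zero]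
    exact if_congr ⟨fun h => ⟨h1, h.symm⟩, fun h => h.2.symm⟩ rfl rfl
  · rw [if_neg fun h => h1 (hiff.1 h), if_neg fun h => h1 h.1]

/-- The matrix entries when one circle becomes one circle. -/
lemma edgeCoeff_single [Finite D] {α β : Γ.Smoothing} {d : D}
    (hα : Γ.circle α (d, true) = Γ.circle α (d, false))
    (hβ : Γ.circle β (d, true) = Γ.circle β (d, false))
    (e : Γ.Circle α ≃ Γ.Circle β) (he : ∀ p, e (Γ.circle α p) = Γ.circle β p)
    (I : Γ.Circle α → ZMod 2) (J : Γ.Circle β → ZMod 2) :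
    Γ.edgeCoeff 2 α β d I J =
      if J = I ∘ e.symm + Pi.single (Γ.circle β (d, true)) 1 then ((Real.sqrt 2 : ℝ) : ℂ)
      else 0 := by
  have he' : ∀ p, e.symm (Γ.circle β p) = Γ.circle α p := fun p => by
    rw [← he, Equiv.symm_apply_apply]
  have hiff : J = I ∘ e.symm + Pi.single (Γ.circle β (d, true)) 1 ↔
      (∀ p : Γ.SidePoint, Γ.circle α p ≠ Γ.circle α (d, true) →
      Γ.circle α p ≠ Γ.circle α (d, false) → J (Γ.circle β p) = I (Γ.circle α p)) ∧
      J (Γ.circle β (d, true)) = I (Γ.circle α (d, true)) + 1 := by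
    constructor
    · rintro rfl
      refine ⟨fun p h1 _ => ?_, by simp [he']⟩
      have : Γ.circle β p ≠ Γ.circle β (d, true) := fun h => h1 (by rw [← he', h, he'])
      simp [he', this]
    · rintro ⟨h1, h2⟩
      funext b
      obtain ⟨p, rfl⟩ := circle_surjective β b
      by_cases hp : Γ.circle α p = Γ.circle α (d, true)
      · have : Γ.circle β p = Γ.circle β (d, true) := by rw [← he, hp, he]
        simp [this, h2, he']
      · have : Γ.circle β p ≠ Γ.circle β (d, true) := fun h => hp (by rw [← he', h, he'])
        simp [he', this, h1 p hp (hα ▸ hp)]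
  have h2 : ((2 / 2 : ℕ) : ZMod 2) = 1 := by decide
  unfold edgeCoeff
  by_cases h1 : ∀ p : Γ.SidePoint, Γ.circle α p ≠ Γ.circle α (d, true) →
      Γ.circle α p ≠ Γ.circle α (d, false) → J (Γ.circle β p) = I (Γ.circle α p)
  · rw [if_pos h1, if_neg (not_not.2 hα), if_neg (not_not.2 hβ), h2]
    exact if_congr ⟨fun h => hiff.2 ⟨h1, h⟩, fun h => (hiff.1 h).2⟩ (by norm_num) rfl
  · rw [if_neg h1, if_neg fun h => h1 (hiff.1 h).1]

/-- The factor of a circle of colour `a` in the normalisation of the coordinates. -/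
noncomputable def circleWeight (a : ZMod 2) : ℂ := ((Real.sqrt 2 : ℝ) : ℂ) * zsign a

lemma circleWeight_ne_zero (a : ZMod 2) : circleWeight a ≠ 0 :=
  mul_ne_zero (by simp) (zsign_ne_zero a)

/-- This fixes the normalisation. With `w` the weight of the affected circle, a merge contributes
`w`, a split `2 / w` and the one-to-one map `√2 · zsign`; all three agree because `w² = 2`. -/
lemma circleWeight_mul_self (a : ZMod 2) : circleWeight a * circleWeight a = 2 := by
  have : ((Real.sqrt 2 : ℝ) : ℂ) * ((Real.sqrt 2 : ℝ) : ℂ) = 2 := by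
    rw [← Complex.ofReal_mul, Real.mul_self_sqrt (by norm_num)]; simp
  unfold circleWeight
  linear_combination zsign a * zsign a * this + 2 * zsign_mul_self a

open Classical in
/-- The normalised coordinate of a vector of the state `α` at the colouring `X`, in the basis of
the idempotents; it is zero if `X` is not a colouring of the circles of `α`. -/
noncomputable def colorFunctional [Finite D] (α : Γ.Smoothing) (X : Γ.SidePoint → ZMod 2) :
    Γ.Space 2 α →ₗ[ℂ] ℂ :=
  if Γ.Compatible α X then
    { toFun := fun f => (∏ c, circleWeight (circleColor X α c))⁻¹ * zfourier (circleColor X α) f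
      map_add' := fun f g => by
        simp only [zfourier, Pi.add_apply, mul_add, Finset.sum_add_distrib]
      map_smul' := fun r f => by
        simp only [zfourier, Pi.smul_apply, smul_eq_mul, Finset.mul_sum, RingHom.id_apply]
        refine Finset.sum_congr rfl fun I _ => ?_
        ring }
  else 0

lemma colorFunctional_of_compatible [Finite D] {α : Γ.Smoothing} {X : Γ.SidePoint → ZMod 2}
    (h : Γ.Compatible α X) (f : Γ.Space 2 α) : colorFunctional α X f =
      (∏ c, circleWeight (circleColor X α c))⁻¹ * zfourier (circleColor X α) f := by
  rw [colorFunctional, if_pos h]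
  rfl

lemma colorFunctional_of_not_compatible [Finite D] {α : Γ.Smoothing} {X : Γ.SidePoint → ZMod 2}
    (h : ¬ Γ.Compatible α X) (f : Γ.Space 2 α) : colorFunctional α X f = 0 := by
  simp [colorFunctional, h]

/-- Every character of the circles comes from a compatible colouring of the side points and the
weights are nonzero, so Fourier inversion applies. -/
lemma eq_zero_of_colorFunctional_eq_zero [Finite D] {α : Γ.Smoothing} (f : Γ.Space 2 α)
    (h : ∀ X, colorFunctional α X f = 0) : f = 0 := by
  refine eq_zero_of_zfourier_eq_zero f fun χ => ?_
  have hX : Γ.Compatible α (χ ∘ Γ.circle α) := fun p q hpq =>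
    congrArg χ (compatible_circle α p q hpq)
  have h1 := h (χ ∘ Γ.circle α)
  rw [colorFunctional_of_compatible hX, mul_eq_zero, inv_eq_zero, Finset.prod_eq_zero_iff] at h1
  have h2 : circleColor (χ ∘ Γ.circle α) α = χ := by
    funext c
    obtain ⟨p, rfl⟩ := circle_surjective α c
    exact hX.circleColor_circle p
  rw [h2] at h1
  exact h1.resolve_left fun ⟨c, _, hc⟩ => circleWeight_ne_zero _ hc

/-- The eigenvalue of the edge map at `d`. -/
noncomputable def edgeScalar (X : Γ.SidePoint → ZMod 2) (d : D) : ℂ :=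
  if X (d, true) = X (d, false) then circleWeight (X (d, true)) else 0

/-- In the normalised coordinates, the edge maps are diagonal, with entries that do not depend on
the states. -/
theorem colorFunctional_edgeMap [Finite D] {α β : Γ.Smoothing} {d : D} (hf : Flip α β d)
    (X : Γ.SidePoint → ZMod 2) (f : Γ.Space 2 α) :
    colorFunctional β X (Γ.edgeMap 2 α β d f) = edgeScalar X d * colorFunctional α X f := by
  by_cases hβX : Γ.Compatible β X
  swap
  -- If `X` is not compatible with `β`, either its values on the strands of `d` agree and `X` is not
  -- compatible with `α` either, or the scalar is zero.
  · rw [colorFunctional_of_not_compatible hβX]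
    by_cases hd : X (d, true) = X (d, false)
    · rw [colorFunctional_of_not_compatible fun h => hβX (h.flip hf hd), mul_zero]
    · simp [edgeScalar, hd]
  have hE : Γ.edgeMap 2 α β d f = fun J => ∑ I, Γ.edgeCoeff 2 α β d I J * f I :=
    funext fun J => edgeMap_apply α β d f J
  rw [colorFunctional_of_compatible hβX, hE]
  by_cases hα : Γ.circle α (d, true) = Γ.circle α (d, false)
  · by_cases hβ : Γ.circle β (d, true) = Γ.circle β (d, false)
    · have hd := hβX.eq_of_circle_eq hβ
      have hαX := hβX.flip hf.symm hd
      obtain ⟨e, he⟩ := exists_equiv_of_single hf hα hβ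
      have hχ : ∀ c, circleColor X β (e c) = circleColor X α c := by
        intro c
        obtain ⟨p, rfl⟩ := circle_surjective α c
        rw [he, hαX.circleColor_circle, hβX.circleColor_circle]
      rw [colorFunctional_of_compatible hαX]
      simp only [edgeCoeff_single hα hβ e he]
      rw [zfourier_shift e _ (circleColor X α) (circleColor X β) hχ, ← e.prod_comp]
      simp only [hχ, hβX.circleColor_circle, edgeScalar, hd, if_true, circleWeight]
      ring
    -- A split is a merge read backwards. If the strands of `d` have different colours, both the
    -- Fourier factor and `edgeScalar` vanish.
    · obtain ⟨e, he, he'⟩ := exists_equiv_of_merge hf.symm hβ hα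
      simp only [edgeCoeff_split hf hα hβ e he he']
      rw [zfourier_split e _ (circleColor X β) (fun c => circleColor X β (e (some c)))
        (fun _ => rfl), he, he' _ hβ, hβX.circleColor_circle, hβX.circleColor_circle]
      by_cases hd : X (d, true) = X (d, false)
      · have hαX := hβX.flip hf.symm hd
        have hχ : ∀ c, circleColor X β (e (some c)) = circleColor X α c := by
          intro c
          obtain ⟨p, rfl⟩ := circle_surjective α c
          rw [hαX.circleColor_circle]
          by_cases hp : Γ.circle β p = Γ.circle β (d, false)
          · have hp' : Γ.circle α p = Γ.circle α (d, true) :=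
              (((compatible_circle α).flip hf hα).eq_of_circle_eq hp).trans hα.symm
            rw [hp', he' _ hβ, hβX.circleColor_circle]
            exact hd.trans (hβX.eq_of_circle_eq hp).symm
          · rw [he' _ hp, hβX.circleColor_circle]
        rw [colorFunctional_of_compatible hαX, ← e.prod_comp, Fintype.prod_option, he,
          hβX.circleColor_circle]
        simp only [hχ, hd, edgeScalar, if_true, ← circleWeight_mul_self (X (d, false)), mul_inv]
        have := circleWeight_ne_zero (X (d, false))
        field_simp
      · simp [hd, edgeScalar, Ne.symm hd]
  · have hβ := (circle_eq_or_circle_eq_of_flip hf).resolve_left hα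
    have hd := hβX.eq_of_circle_eq hβ
    have hαX := hβX.flip hf.symm hd
    obtain ⟨e, he, he'⟩ := exists_equiv_of_merge hf hα hβ
    have hχ : ∀ c, circleColor X α (e (some c)) = circleColor X β c := by
      intro c
      obtain ⟨p, rfl⟩ := circle_surjective β c
      rw [hβX.circleColor_circle]
      by_cases hp : Γ.circle α p = Γ.circle α (d, false)
      · have hp' : Γ.circle β p = Γ.circle β (d, true) :=
          (((compatible_circle β).flip hf.symm hβ).eq_of_circle_eq hp).trans hβ.symm
        rw [hp', he' _ hα, hαX.circleColor_circle]
        exact hd.trans (hαX.eq_of_circle_eq hp).symm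
      · rw [he' _ hp, hαX.circleColor_circle]
    simp only [edgeCoeff_merge hf hα hβ e he he']
    rw [zfourier_merge e _ (circleColor X α) (circleColor X β) hχ
      (by rw [he, hαX.circleColor_circle, hβX.circleColor_circle, hd]),
      colorFunctional_of_compatible hαX, ← e.prod_comp, Fintype.prod_option, he,
      hαX.circleColor_circle]
    simp only [hχ, hd, edgeScalar, if_true, mul_inv]
    have := circleWeight_ne_zero (X (d, false))
    field_simp

end RibbonGraph

/-! ### Vertex maps and the vanishing of the squared differential. -/

namespace RibbonGraph

variable {V D : Type*} {Γ : RibbonGraph V D}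

/-- The eigenvalue of the vertex map at `v`. -/
noncomputable def vertexScalar [Fintype D] (X : Γ.SidePoint → ZMod 2) (v : V) : ℂ :=
  letI : Fintype (Γ.HalfEdgesAt v) := Fintype.ofFinite _
  ∏ d : Γ.HalfEdgesAt v, edgeScalar X (d : D)

/-- The product over the half-edges at `v` ignores their order; this is why the choice of paths is
immaterial. -/
lemma vertexScalar_eq [Fintype D] (X : Γ.SidePoint → ZMod 2) {v : V} (e : Fin 3 ≃ Γ.HalfEdgesAt v) :
    vertexScalar X v = edgeScalar X (e 0 : D) * edgeScalar X (e 1 : D) * edgeScalar X (e 2 : D) := by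
  let _ : Fintype (Γ.HalfEdgesAt v) := Fintype.ofFinite _
  rw [vertexScalar, ← e.prod_comp, Fin.prod_univ_three]

/-- In the normalised coordinates, the vertex maps are diagonal, with entries that do not depend on
the states and the paths. -/
lemma colorFunctional_vertexMap [Fintype D] [DecidableEq D] [DecidableEq V] (path : Γ.PathChoice)
    {ν : V → Bool} {v : V} (hν : ν v = false) (X : Γ.SidePoint → ZMod 2)
    (f : Γ.Space 2 (Γ.vertexSmoothing ν)) :
    colorFunctional (Γ.vertexSmoothing (Function.update ν v true)) X
        (Γ.vertexMap 2 path ν (Function.update ν v true) v f) =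
      vertexScalar X v * colorFunctional (Γ.vertexSmoothing ν) X f := by
  set e := path ν v with he
  have hv : ∀ k, Γ.vert (e k : D) = v := fun k => (e k).2
  have hne : ∀ j k, j ≠ k → (e j : D) ≠ e k := fun j k hjk h =>
    hjk (e.injective (Subtype.ext h))
  have f0 : Flip (Γ := Γ) (Γ.vertexSmoothing ν)
      (Function.update (Γ.vertexSmoothing ν) (e 0 : D) true) (e 0 : D) :=
    ⟨fun d' hd => by simp [hd], by simp [vertexSmoothing, hv, hν]⟩
  have f1 : Flip (Γ := Γ) (Function.update (Γ.vertexSmoothing ν) (e 0 : D) true)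
      (Function.update (Function.update (Γ.vertexSmoothing ν) (e 0 : D) true) (e 1 : D) true)
      (e 1 : D) :=
    ⟨fun d' hd => by simp [hd], by simp [vertexSmoothing, hv, hν, hne 1 0]⟩
  -- The path ends at the vertex smoothing because `e` exhausts the half-edges at `v`.
  have f2 : Flip
      (Function.update (Function.update (Γ.vertexSmoothing ν) (e 0 : D) true) (e 1 : D) true)
      (Γ.vertexSmoothing (Function.update ν v true)) (e 2 : D) := by
    refine ⟨fun d' hd => ?_, by simp [vertexSmoothing, hv, hν, hne 2 1, hne 2 0]⟩
    by_cases hd' : Γ.vert d' = v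
    · obtain ⟨k, hk⟩ := e.surjective ⟨d', hd'⟩
      have hk' : (e k : D) = d' := by rw [hk]
      subst hk'
      have h01 : k = 0 ∨ k = 1 := by
        fin_cases k
        · exact Or.inl rfl
        · exact Or.inr rfl
        · exact absurd rfl hd
      rcases h01 with rfl | rfl
      · simp [vertexSmoothing, hv, hne 0 1]
      · simp [vertexSmoothing, hv]
    · have h0 : d' ≠ e 0 := fun h => hd' (by rw [h, hv])
      have h1 : d' ≠ e 1 := fun h => hd' (by rw [h, hv])
      simp [vertexSmoothing, hd', h0, h1]
  simp only [vertexMap, LinearMap.comp_apply, ← he]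
  rw [colorFunctional_edgeMap f2, colorFunctional_edgeMap f1, colorFunctional_edgeMap f0,
    vertexScalar_eq X e]
  ring

lemma weight_update [Fintype V] [DecidableEq V] {ν : V → Bool} {v : V} (hν : ν v = false) :
    weight (Function.update ν v true) = weight ν + 1 := by
  have : (Finset.univ.filter fun u => Function.update ν v true u = true) =
      insert v (Finset.univ.filter fun u => ν u = true) := by
    ext u
    by_cases hu : u = v
    · subst hu; simp
    · simp [hu]
  rw [weight, this, Finset.card_insert_of_notMem (by simp [hν]), weight]

/-- The term for `v < w` gives the two orders of changing `v` and `w` opposite signs. -/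
lemma onesBefore_update [Fintype V] [LinearOrder V] {ν : V → Bool} {v : V} (hν : ν v = false)
    (w : V) : onesBefore (Function.update ν v true) w =
      onesBefore ν w + if v < w then 1 else 0 := by
  unfold onesBefore
  split_ifs with h
  · have : (Finset.univ.filter fun u => u < w ∧ Function.update ν v true u = true) =
        insert v (Finset.univ.filter fun u => u < w ∧ ν u = true) := by
      ext u
      by_cases hu : u = v
      · subst hu; simp [h]
      · simp [hu]
    rw [this, Finset.card_insert_of_notMem (by simp [hν])]
  · congr 1
    ext u
    by_cases hu : u = v
    · subst hu; simp [h]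
    · simp [hu]

variable [Fintype V] [LinearOrder V] [Fintype D] [DecidableEq D]

lemma colorFunctional_differential (path : Γ.PathChoice) (i : ℕ) (X : Γ.SidePoint → ZMod 2)
    (f : Γ.Chain 2 i) (ν' : {ν : V → Bool // weight ν = i + 1}) :
    colorFunctional (Γ.vertexSmoothing ν'.1) X (Γ.differential 2 path i f ν') =
      ∑ ν : {ν : V → Bool // weight ν = i}, ∑ v : V,
        if ν.1 v = false ∧ ν'.1 = Function.update ν.1 v true then
          (-1 : ℂ) ^ onesBefore ν.1 v *
            (vertexScalar X v * colorFunctional (Γ.vertexSmoothing ν.1) X (f ν))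
        else 0 := by
  simp only [differential, LinearMap.pi_apply, LinearMap.sum_apply, map_sum]
  refine Finset.sum_congr rfl fun ν _ => Finset.sum_congr rfl fun v _ => ?_
  split_ifs with h
  · obtain ⟨ν', hν'⟩ := ν'
    obtain ⟨h1, rfl⟩ := h
    simp only [LinearMap.smul_apply, LinearMap.comp_apply, LinearMap.proj_apply, map_smul,
      smul_eq_mul]
    rw [colorFunctional_vertexMap path h1]
  · simp

/-- The vertex maps commute, so the signed sum squares to zero. -/
theorem differential_comp_differential (path : Γ.PathChoice) (i : ℕ) :
    Γ.differential 2 path (i + 1) ∘ₗ Γ.differential 2 path i = 0 := by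
  refine LinearMap.ext fun f => funext fun ν'' => ?_
  refine eq_zero_of_colorFunctional_eq_zero _ fun X => ?_
  set c : {ν : V → Bool // weight ν = i} → ℂ :=
    fun ν => colorFunctional (Γ.vertexSmoothing ν.1) X (f ν) with hc
  -- The contribution of changing first `v` and then `w`. It is antisymmetric in `v` and `w`, since
  -- the scalars commute and exactly one of `v < w`, `w < v` holds when they differ.
  let F : {ν : V → Bool // weight ν = i} → V → V → ℂ := fun ν v w =>
    if ν.1 v = false ∧ Function.update ν.1 v true w = false ∧
        ν''.1 = Function.update (Function.update ν.1 v true) w true then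
      (-1 : ℂ) ^ onesBefore (Function.update ν.1 v true) w * (vertexScalar X w *
        ((-1 : ℂ) ^ onesBefore ν.1 v * (vertexScalar X v * c ν))) else 0
  have hF : ∀ ν v w, F ν w v = - F ν v w := by
    intro ν v w
    simp only [F]
    by_cases hvw : v = w
    · subst hvw; simp
    by_cases hv : ν.1 v = false
    swap
    · simp [hv, hvw]
    by_cases hw : ν.1 w = false
    swap
    · simp [hw, Ne.symm hvw]
    rw [Function.update_comm hvw]
    simp only [hv, hw, Function.update_of_ne hvw, Function.update_of_ne (Ne.symm hvw), true_and,
      onesBefore_update hv, onesBefore_update hw]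
    split_ifs with h1 h2 h3 h3
    · exact absurd h2 (not_lt.2 h3.le)
    · simp only [pow_add]; ring
    · simp only [pow_add]; ring
    · exact absurd (le_antisymm (not_lt.1 h2) (not_lt.1 h3)) (by tauto)
    · simp
  have hsum : ∀ ν, ∑ v, ∑ w, F ν v w = 0 := by
    intro ν
    have h1 : ∑ v, ∑ w, F ν v w = - ∑ v, ∑ w, F ν v w := by
      calc ∑ v, ∑ w, F ν v w = ∑ v, ∑ w, - F ν w v :=
            Finset.sum_congr rfl fun v _ => Finset.sum_congr rfl fun w _ => hF ν w v
        _ = - ∑ v, ∑ w, F ν w v := by simp only [Finset.sum_neg_distrib]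
        _ = - ∑ v, ∑ w, F ν v w := by rw [Finset.sum_comm]
    exact self_eq_neg.mp h1
  -- The same contribution with the intermediate state `ν'` kept as a variable; only one `ν'` gives
  -- a nonzero term.
  let T : {ν : V → Bool // weight ν = i} → V → V → {ν : V → Bool // weight ν = i + 1} → ℂ :=
    fun ν v w ν' => if ν'.1 w = false ∧ ν''.1 = Function.update ν'.1 w true then
      (-1 : ℂ) ^ onesBefore ν'.1 w * (vertexScalar X w *
        (if ν.1 v = false ∧ ν'.1 = Function.update ν.1 v true then
          (-1 : ℂ) ^ onesBefore ν.1 v * (vertexScalar X v * c ν) else 0)) else 0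
  have hT : ∀ ν v w, ∑ ν', T ν v w ν' = F ν v w := by
    intro ν v w
    by_cases hv : ν.1 v = false
    · rw [Finset.sum_eq_single ⟨Function.update ν.1 v true, by rw [weight_update hv, ν.2]⟩]
      · simp only [T, F, hv, true_and, if_true]
      · intro ν' _ hν'
        have : ν'.1 ≠ Function.update ν.1 v true := fun h => hν' (Subtype.ext h)
        simp [T, this]
      · simp
    · simp [T, F, hv]
  calc _ = ∑ ν', ∑ w, ∑ ν, ∑ v, T ν v w ν' := by
        rw [LinearMap.comp_apply, colorFunctional_differential]
        refine Finset.sum_congr rfl fun ν' _ => Finset.sum_congr rfl fun w _ => ?_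
        rw [colorFunctional_differential]
        simp only [T]
        split_ifs with h
        · simp only [Finset.mul_sum, hc]
        · simp
    _ = ∑ ν, ∑ v, ∑ w, ∑ ν', T ν v w ν' := by
        rw [Finset.sum_comm]
        simp_rw [Finset.sum_comm (s := Finset.univ (α := {ν : V → Bool // weight ν = i + 1}))]
        rw [Finset.sum_comm]
        refine Finset.sum_congr rfl fun ν _ => ?_
        rw [Finset.sum_comm]
    _ = 0 := by simp only [hT, hsum, Finset.sum_const_zero]

end RibbonGraph

/-! ### The Euler–Poincaré principle. -/

namespace RibbonGraph

variable {V D : Type*} {Γ : RibbonGraph V D}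

/-- The colourings of the circles of a state. -/
def circleColoringEquiv (Γ : RibbonGraph V D) (α : Γ.Smoothing) (T : Type*) :
    (Γ.Circle α → T) ≃ {X : Γ.SidePoint → T // Γ.Compatible α X} where
  toFun χ := ⟨χ ∘ Γ.circle α, fun p q h => congrArg χ (compatible_circle α p q h)⟩
  invFun X := Quot.lift X.1 X.2
  left_inv χ := by
    funext c
    obtain ⟨p, rfl⟩ := circle_surjective α c
    rfl
  right_inv X := rfl

lemma weight_le [Fintype V] (ν : V → Bool) : weight ν ≤ Fintype.card V := Finset.card_le_univ _

lemma finrank_chain [Fintype V] [LinearOrder V] [Fintype D] (i : ℕ) : Module.finrank ℂ (Γ.Chain 2 i) =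
    ∑ ν : {ν : V → Bool // weight ν = i}, 2 ^ Nat.card (Γ.Circle (Γ.vertexSmoothing ν.1)) := by
  rw [Module.finrank_pi_fintype]
  refine Finset.sum_congr rfl fun ν _ => ?_
  rw [Module.finrank_fintype_fun_eq_card, Fintype.card_fun, ZMod.card, Nat.card_eq_fintype_card]

variable [Fintype V] [LinearOrder V] [Fintype D] [DecidableEq D]

lemma boundaries_le_cycles (path : Γ.PathChoice) (i : ℕ) :
    Γ.boundaries 2 path i ≤ Γ.cycles 2 path i := by
  cases i with
  | zero => exact bot_le
  | succ i =>
    rintro _ ⟨f, rfl⟩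
    exact LinearMap.congr_fun (differential_comp_differential path i) f

/-- Rank–nullity twice, stated with additions only to avoid truncated subtraction. -/
lemma finrank_homology (path : Γ.PathChoice) (i : ℕ) :
    Module.finrank ℂ (Γ.FilteredVertexHomology 2 path i) +
      Module.finrank ℂ (Γ.boundaries 2 path i) + Module.finrank ℂ (Γ.boundaries 2 path (i + 1)) =
        Module.finrank ℂ (Γ.Chain 2 i) := by
  have h1 := Submodule.finrank_quotient_add_finrank
    ((Γ.boundaries 2 path i).submoduleOf (Γ.cycles 2 path i))
  rw [(Submodule.submoduleOfEquivOfLe (boundaries_le_cycles path i)).finrank_eq] at h1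
  have h2 := LinearMap.finrank_range_add_finrank_ker (Γ.differential 2 path i)
  change Module.finrank ℂ (Γ.boundaries 2 path (i + 1)) +
    Module.finrank ℂ (Γ.cycles 2 path i) = _ at h2
  rw [← h2, ← h1]
  ring

/-- The Euler–Poincaré principle for the filtered vertex homology. -/
theorem filteredEulerChar_eq (path : Γ.PathChoice) : Γ.filteredEulerChar 2 path =
    ∑ ν : V → Bool, (-1 : ℤ) ^ weight ν *
      2 ^ Nat.card (Γ.Circle (Γ.vertexSmoothing ν)) := by
  -- The boundary ranks telescope to a single end term, which vanishes for `n = |V| + 1` because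
  -- there are no chains in that degree.
  have tele : ∀ n : ℕ, ∑ i ∈ Finset.range n, (-1 : ℤ) ^ i *
      (Module.finrank ℂ (Γ.FilteredVertexHomology 2 path i) : ℤ) =
      ∑ i ∈ Finset.range n, (-1 : ℤ) ^ i * (Module.finrank ℂ (Γ.Chain 2 i) : ℤ) +
        (-1) ^ n * (Module.finrank ℂ (Γ.boundaries 2 path n) : ℤ) := by
    intro n
    induction n with
    | zero =>
      have : Module.finrank ℂ (Γ.boundaries 2 path 0) = 0 := finrank_bot ℂ _
      simp [this]
    | succ n ih =>
      rw [Finset.sum_range_succ, Finset.sum_range_succ, ih, ← finrank_homology path n]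
      push_cast
      ring
  have htop : Module.finrank ℂ (Γ.boundaries 2 path (Fintype.card V + 1)) = 0 := by
    have : IsEmpty {ν : V → Bool // weight ν = Fintype.card V + 1} :=
      ⟨fun ν => by have := weight_le ν.1; omega⟩
    have h0 : Module.finrank ℂ (Γ.Chain 2 (Fintype.card V + 1)) = 0 := by
      rw [finrank_chain]; simp
    exact Nat.le_zero.mp (h0 ▸ Submodule.finrank_le _)
  rw [filteredEulerChar, tele, htop]
  simp only [Nat.cast_zero, mul_zero, add_zero]
  rw [← Finset.sum_fiberwise_of_maps_to (s := Finset.univ)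
    (t := Finset.range (Fintype.card V + 1)) (g := weight)
    (fun ν _ => Finset.mem_range.mpr (Nat.lt_succ_of_le (weight_le ν)))]
  refine Finset.sum_congr rfl fun i _ => ?_
  rw [finrank_chain, Finset.sum_subtype (p := fun ν : V → Bool => weight ν = i) _ (by simp)]
  push_cast
  rw [Finset.mul_sum]
  refine Finset.sum_congr rfl fun ν _ => ?_
  rw [ν.2]

end RibbonGraph

/-! ### Edges, vertices and faces: mod 2 cycles of a plane graph. -/

lemma finrank_le_one_of_const {ι K : Type*} [Fintype ι] [Field K] (S : Submodule K (ι → K))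
    (h : ∀ f ∈ S, ∀ i j, f i = f j) : Module.finrank K S ≤ 1 := by
  have hle : S ≤ Submodule.span K {fun _ => (1 : K)} := by
    intro f hf
    rcases isEmpty_or_nonempty ι with hι | ⟨⟨i⟩⟩
    · rw [Subsingleton.elim f 0]; exact zero_mem _
    · refine Submodule.mem_span_singleton.mpr ⟨f i, ?_⟩
      funext j
      simp [h f hf i j]
  refine (Submodule.finrank_mono hle).trans ?_
  simpa using finrank_span_le_card (R := K) ({fun _ => (1 : K)} : Set (ι → K))

namespace HalfEdgeGraph

variable {V D : Type*} (G : HalfEdgeGraph V D)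

lemma edge_eq_iff (d d' : D) : G.edge d = G.edge d' ↔ d' = d ∨ d' = G.opp d := by
  have h1 : G.edge d = G.edge d' ↔ G.opp.SameCycle d d' :=
    Quotient.eq (r := Equiv.Perm.SameCycle.setoid G.opp)
  rw [h1]
  have h2 : G.opp ^ (2 : ℤ) = 1 := by
    ext x
    simp [zpow_ofNat, pow_two, G.opp_opp]
  constructor
  · rintro ⟨i, rfl⟩
    rcases Int.even_or_odd' i with ⟨k, rfl | rfl⟩
    · left; rw [zpow_mul, h2]; simp
    · right; rw [zpow_add, zpow_mul, h2]; simp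
  · rintro (rfl | rfl)
    · exact Equiv.Perm.SameCycle.refl _ _
    · exact ⟨1, by simp⟩

lemma edge_opp (d : D) : G.edge (G.opp d) = G.edge d :=
  ((G.edge_eq_iff d (G.opp d)).2 (Or.inr rfl)).symm

/-- The two halves of each edge. -/
lemma exists_edge_equiv : ∃ ψ : G.Edge × Bool ≃ D,
    (∀ e b, G.edge (ψ (e, b)) = e) ∧ ∀ e b, G.opp (ψ (e, b)) = ψ (e, !b) := by
  let F : G.Edge × Bool → D := fun x => if x.2 then G.opp x.1.out else x.1.out
  have hout : ∀ e : G.Edge, G.edge e.out = e := fun e => Quotient.out_eq e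
  have hedge : ∀ e b, G.edge (F (e, b)) = e := by
    rintro e (_ | _) <;> simp [F, edge_opp, hout]
  have hF : Function.Bijective F := by
    constructor
    · rintro ⟨e, b⟩ ⟨e', b'⟩ h
      have he : e = e' := by rw [← hedge e b, h, hedge]
      subst he
      cases b <;> cases b' <;> simp [F] at h ⊢
      · exact G.opp_ne _ h.symm
      · exact G.opp_ne _ h
    · intro d
      rcases (G.edge_eq_iff _ _).1 (hout (G.edge d)) with h | h
      · exact ⟨(G.edge d, false), h.symm⟩
      · exact ⟨(G.edge d, true), h.symm⟩
  refine ⟨Equiv.ofBijective F hF, hedge, ?_⟩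
  rintro e (_ | _) <;> simp [F, G.opp_opp]

instance [Finite D] : Finite G.Edge := inferInstanceAs (Finite (Quotient _))

end HalfEdgeGraph

namespace RibbonGraph

variable {V D : Type*} (Γ : RibbonGraph V D)

instance [Finite D] : Finite Γ.Face := inferInstanceAs (Finite (Quotient _))

/-- The face to which a half-edge belongs. -/
def face (d : D) : Γ.Face := Quotient.mk (Equiv.Perm.SameCycle.setoid (Γ.rot * Γ.opp)) d

lemma face_rot_opp (d : D) : Γ.face (Γ.rot (Γ.opp d)) = Γ.face d :=
  Quotient.sound (s := Equiv.Perm.SameCycle.setoid (Γ.rot * Γ.opp))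
    (Equiv.Perm.SameCycle.symm ⟨1, by simp⟩)

/-- The three half-edges at each vertex, in cyclic order. -/
lemma exists_vertex_equiv [Fintype D] (htri : Γ.IsTrivalent) : ∃ φ : V × Fin 3 ≃ D,
    (∀ v k, Γ.vert (φ (v, k)) = v) ∧ ∀ v k, Γ.rot (φ (v, k)) = φ (v, k + 1) := by
  classical
  choose b hb using Γ.vert_surjective
  -- The support of `cycleOf` is empty at a fixed point, so fixed points must be excluded before
  -- supports are counted.
  have hmoved : ∀ v, Γ.rot (b v) ≠ b v := by
    intro v h
    have key : ∀ x : Γ.HalfEdgesAt v, (x : D) = b v := by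
      intro x
      obtain ⟨i, hi⟩ := (Γ.vert_eq_iff (b v) x).1 ((hb v).trans x.2.symm)
      exact hi.symm.trans (Equiv.Perm.zpow_apply_eq_self_of_apply_eq_self h i)
    have hsub : Subsingleton (Γ.HalfEdgesAt v) :=
      ⟨fun x y => Subtype.ext ((key x).trans (key y).symm)⟩
    have h1 : Nat.card (Γ.HalfEdgesAt v) = 1 := Nat.card_of_subsingleton ⟨b v, hb v⟩
    rw [htri v] at h1
    norm_num at h1
  have hS : ∀ v, (Γ.rot.cycleOf (b v)).support.card = 3 := by
    intro v
    rw [← htri v, Nat.card_eq_fintype_card, Fintype.card_subtype]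
    congr 1
    ext d
    rw [Equiv.Perm.mem_support_cycleOf_iff' (hmoved v), ← Γ.vert_eq_iff, hb]
    simp [eq_comm]
  have hp3 : ∀ v, (Γ.rot ^ 3) (b v) = b v := fun v => by
    rw [← hS v]
    exact (Γ.rot.isCycleOn_support_cycleOf (b v)).pow_card_apply
      ((Equiv.Perm.mem_support_cycleOf_iff' (hmoved v)).2 (Equiv.Perm.SameCycle.refl _ _))
  let F : V × Fin 3 → D := fun x => (Γ.rot ^ (x.2 : ℕ)) (b x.1)
  have hvert : ∀ v k, Γ.vert (F (v, k)) = v := by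
    intro v k
    rw [← hb v]
    refine ((Γ.vert_eq_iff _ _).2 ?_).symm
    rw [hb]
    exact ⟨(k : ℕ), by simp [F]⟩
  have hsurj : Function.Surjective F := by
    intro d
    have hsc := (Γ.vert_eq_iff (b (Γ.vert d)) d).1 (hb _)
    obtain ⟨i, hi, h⟩ := hsc.exists_pow_eq_of_mem_support (Equiv.Perm.mem_support.2 (hmoved _))
    rw [hS] at hi
    exact ⟨(Γ.vert d, ⟨i, hi⟩), h⟩
  have hinj : Function.Injective F := by
    rintro ⟨v, k⟩ ⟨w, l⟩ h
    have hvw : v = w := by rw [← hvert v k, h, hvert]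
    subst hvw
    have : Function.Injective fun k => (⟨F (v, k), hvert v k⟩ : Γ.HalfEdgesAt v) := by
      have hs : Function.Surjective fun k => (⟨F (v, k), hvert v k⟩ : Γ.HalfEdgesAt v) := by
        rintro ⟨d, rfl⟩
        obtain ⟨⟨w, k⟩, rfl⟩ := hsurj d
        have hw := hvert w k
        refine ⟨k, Subtype.ext ?_⟩
        simp only
        rw [hw]
      refine ((Fintype.bijective_iff_surjective_and_card _).2 ⟨hs, ?_⟩).1
      rw [← Nat.card_eq_fintype_card (α := Γ.HalfEdgesAt v), htri v, Fintype.card_fin]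
    rw [this (Subtype.ext h)]
  refine ⟨Equiv.ofBijective F ⟨hinj, hsurj⟩, hvert, ?_⟩
  intro v k
  change Γ.rot ((Γ.rot ^ (k : ℕ)) (b v)) = (Γ.rot ^ ((k + 1 : Fin 3) : ℕ)) (b v)
  rw [← Equiv.Perm.mul_apply, ← pow_succ']
  fin_cases k
  · rfl
  · rfl
  · exact hp3 v

variable {Γ}

/-- In a plane graph, every cycle modulo 2 bounds a set of faces. -/
theorem IsPlane.exists_face_coloring [Fintype V] [Fintype D] (hplane : Γ.IsPlane)
    (φ : V × Fin 3 ≃ D)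
    (hφ : ∀ v k, Γ.vert (φ (v, k)) = v) (hrot : ∀ v k, Γ.rot (φ (v, k)) = φ (v, k + 1))
    (z : Γ.Edge → ZMod 2) (hz : ∀ v, ∑ k, z (Γ.edge (φ (v, k))) = 0) :
    ∃ g : D → ZMod 2, (∀ d, g (Γ.rot (Γ.opp d)) = g d) ∧
      ∀ d, g d + g (Γ.opp d) = z (Γ.edge d) := by
  classical
  obtain ⟨⟨⟨v₀⟩, hconn⟩, hχ⟩ := hplane
  obtain ⟨ψ, hψ, hopp⟩ := Γ.exists_edge_equiv
  let _ : Fintype Γ.Edge := Fintype.ofFinite _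
  let _ : Fintype Γ.Face := Fintype.ofFinite _
  -- The incidence matrix modulo 2. The sum runs over the halves of the edge, so a loop gives `1 + 1
  -- = 0`.
  let A : Matrix Γ.Edge V (ZMod 2) := fun e v =>
    ∑ b, if Γ.vert (ψ (e, b)) = v then 1 else 0
  have hA : ∀ w e, A.mulVec w e = ∑ b, w (Γ.vert (ψ (e, b))) := by
    intro w e
    simp only [Matrix.mulVec, dotProduct, A, Finset.sum_mul]
    rw [Finset.sum_comm]
    simp
  have hAt : ∀ y v, A.transpose.mulVec y v = ∑ k, y (Γ.edge (φ (v, k))) := by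
    intro y v
    have h1 : A.transpose.mulVec y v =
        ∑ x : Γ.Edge × Bool, (if Γ.vert (ψ x) = v then y (Γ.edge (ψ x)) else 0) := by
      rw [Fintype.sum_prod_type]
      refine Finset.sum_congr rfl fun e _ => ?_
      change (∑ b, if Γ.vert (ψ (e, b)) = v then 1 else 0) * y e = _
      simp only [Finset.sum_mul, hψ, ite_mul, one_mul, zero_mul]
    rw [h1, ψ.sum_comp (fun d => if Γ.vert d = v then y (Γ.edge d) else 0),
      ← φ.sum_comp, Fintype.sum_prod_type]
    simp only [hφ]
    rw [Finset.sum_eq_single v (fun w _ hw => by simp [hw]) (by simp)]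
    simp
  let δ : (Γ.Face → ZMod 2) →ₗ[ZMod 2] (Γ.Edge → ZMod 2) :=
    { toFun := fun g e => ∑ b, g (Γ.face (ψ (e, b)))
      map_add' := fun f g => by funext e; simp only [Pi.add_apply, Finset.sum_add_distrib]
      map_smul' := fun r g => by
        funext e; simp only [Pi.smul_apply, smul_eq_mul, Finset.mul_sum, RingHom.id_apply] }
  have hpair : ∀ (T : D → ZMod 2) d, ∑ b, T (ψ (Γ.edge d, b)) = T d + T (Γ.opp d) := by
    intro T d
    obtain ⟨⟨e, b⟩, rfl⟩ := ψ.surjective d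
    rw [hψ, hopp]
    cases b <;> simp [add_comm]
  have hδ : ∀ g d, δ g (Γ.edge d) = g (Γ.face d) + g (Γ.face (Γ.opp d)) :=
    fun g d => hpair (fun d => g (Γ.face d)) d
  have hconst : ∀ w : V → ZMod 2, (∀ d, w (Γ.vert d) = w (Γ.vert (Γ.opp d))) →
      ∀ u v, w u = w v := by
    intro w hw u v
    have := hconn u v
    induction this with
    | refl => rfl
    | tail _ hj ih =>
      obtain ⟨d, rfl, rfl⟩ := hj
      exact ih.trans (hw d)
  have hkerA : Module.finrank (ZMod 2) (LinearMap.ker A.mulVecLin) ≤ 1 := by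
    refine finrank_le_one_of_const _ fun w hw => hconst w fun d => ?_
    have h1 : A.mulVec w (Γ.edge d) = 0 := congrFun hw _
    rw [hA, hpair (fun d => w (Γ.vert d))] at h1
    exact CharTwo.add_eq_zero.mp h1
  have hkerδ : Module.finrank (ZMod 2) (LinearMap.ker δ) ≤ 1 := by
    refine finrank_le_one_of_const _ fun g hg => ?_
    have h1 : ∀ d, g (Γ.face d) = g (Γ.face (Γ.opp d)) := fun d => by
      have h1 : δ g (Γ.edge d) = 0 := congrFun hg _
      rw [hδ] at h1
      exact CharTwo.add_eq_zero.mp h1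
    have h2 : ∀ d, g (Γ.face (Γ.rot d)) = g (Γ.face d) := fun d => by
      have := Γ.face_rot_opp (Γ.opp d)
      rw [Γ.opp_opp] at this
      rw [this, ← h1]
    have h3 : ∀ d d', Γ.vert d = Γ.vert d' → g (Γ.face d) = g (Γ.face d') := by
      intro d d' h
      obtain ⟨⟨v, k⟩, rfl⟩ := φ.surjective d
      obtain ⟨⟨w, l⟩, rfl⟩ := φ.surjective d'
      rw [hφ, hφ] at h
      subst h
      have h4 : ∀ k, g (Γ.face (φ (v, k + 1))) = g (Γ.face (φ (v, k))) := fun k => by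
        rw [← hrot, h2]
      have h5 : ∀ k, g (Γ.face (φ (v, k))) = g (Γ.face (φ (v, 0))) := fun k => by
        fin_cases k
        · rfl
        · exact h4 0
        · exact (h4 1).trans (h4 0)
      exact (h5 k).trans (h5 l).symm
    have h7 := hconst (fun v => g (Γ.face (φ (v, 0)))) fun d =>
      (h3 _ d (hφ _ _)).trans ((h1 d).trans (h3 _ _ (hφ _ _)).symm)
    have h8 : ∀ d, g (Γ.face d) = g (Γ.face (φ (v₀, 0))) := fun d =>
      (h3 d (φ (Γ.vert d, 0)) (hφ _ _).symm).trans (h7 _ _)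
    intro a b
    obtain ⟨d, rfl⟩ := Quotient.exists_rep a
    obtain ⟨d', rfl⟩ := Quotient.exists_rep b
    exact (h8 d).trans (h8 d').symm
  have hle : LinearMap.range δ ≤ LinearMap.ker A.transpose.mulVecLin := by
    rintro _ ⟨g, rfl⟩
    refine funext fun v => ?_
    change A.transpose.mulVec (δ g) v = 0
    rw [hAt]
    -- The face of `opp d` is that of `rot d`, so around a vertex each face value occurs twice and
    -- cancels.
    have h1 : ∀ k, δ g (Γ.edge (φ (v, k))) =
        g (Γ.face (φ (v, k))) + g (Γ.face (φ (v, k + 1))) := by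
      intro k
      rw [hδ, ← hrot, ← Γ.face_rot_opp (Γ.opp (φ (v, k))), Γ.opp_opp]
    simp only [h1, Fin.sum_univ_three]
    have : ∀ a b c : ZMod 2, a + b + (b + c) + (c + a) = 0 := by decide
    exact this _ _ _
  -- By connectivity both kernels have dimension at most 1. So the cycle space has dimension at most
  -- `|E| - |V| + 1`, the range of `δ` at least `|F| - 1`, and these bounds are equal since the
  -- surface is a sphere.
  have hdim : Module.finrank (ZMod 2) (LinearMap.ker A.transpose.mulVecLin) ≤
      Module.finrank (ZMod 2) (LinearMap.range δ) := by
    have e1 := LinearMap.finrank_range_add_finrank_ker A.transpose.mulVecLin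
    have e2 := LinearMap.finrank_range_add_finrank_ker A.mulVecLin
    have e3 := LinearMap.finrank_range_add_finrank_ker δ
    have e4 : Module.finrank (ZMod 2) (LinearMap.range A.transpose.mulVecLin) =
        Module.finrank (ZMod 2) (LinearMap.range A.mulVecLin) := A.rank_transpose
    rw [Module.finrank_fintype_fun_eq_card] at e1 e2 e3
    unfold surfaceEulerChar at hχ
    rw [Nat.card_eq_fintype_card, Nat.card_eq_fintype_card, Nat.card_eq_fintype_card] at hχ
    omega
  have heq := Submodule.eq_of_le_of_finrank_le hle hdim
  have hzmem : z ∈ LinearMap.range δ := by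
    rw [heq]
    exact funext fun v => (hAt z v).trans (hz v)
  obtain ⟨g, rfl⟩ := hzmem
  exact ⟨fun d => g (Γ.face d), fun d => congrArg g (Γ.face_rot_opp d), fun d => (hδ g d).symm⟩

end RibbonGraph

/-! ### Pauli matrices and local signs. -/

/-- The entries of the three real Pauli matrices, the second one multiplied by `i`. -/
def pauli (x : Bool → ZMod 2) (i : Fin 3) : ℤ :=
  match i with
  | 0 => if x true = x false then 0 else 1
  | 1 => if x true = x false then 0 else if x true = 0 then 1 else -1
  | 2 => if x true = x false then (if x true = 0 then 1 else -1) else 0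

/-- The sign of a bijective triple, and zero for the other triples. -/
def levi (t : Fin 3 → Fin 3) : ℤ :=
  if t 1 = t 0 + 1 ∧ t 2 = t 0 + 2 then 1 else if t 1 = t 0 + 2 ∧ t 2 = t 0 + 1 then -1 else 0

/-- The sign of the square of a Pauli matrix. -/
def pauliSign (i : Fin 3) : ℤ := if i = 1 then -1 else 1

/-- The vertex weight: the contribution of the two smoothings of a vertex to the state sum, for
given colours of the six strands. -/
def vertexWeight (x : Fin 3 → Bool → ZMod 2) : ℤ :=
  (if ∀ k, x k true = x (k + 1) false then 1 else 0) -
    if ∀ k, x k false = x (k + 1) true then 1 else 0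

/-- Paired with three 2×2 matrices, the weight is the difference of the traces of their products in
the two cyclic orders. This alternates and vanishes on the identity, so only `levi` times Pauli
matrices survives. -/
lemma two_mul_vertexWeight : ∀ x : Fin 3 → Bool → ZMod 2,
    2 * vertexWeight x = ∑ t : Fin 3 → Fin 3, levi t * ∏ k, pauli (x k) (t k) := by
  decide +kernel

/-- Exchanging left and right transposes a matrix, so the sum is the trace of a product of two Pauli
matrices. -/
lemma sum_pauli_mul_pauli : ∀ i j : Fin 3,
    ∑ x : Bool → ZMod 2, pauli x i * pauli (fun s => x (!s)) j =
      if i = j then 2 * pauliSign i else 0 := by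
  decide +kernel

lemma pauliSign_mul_self : ∀ i, pauliSign i * pauliSign i = 1 := by decide

lemma levi_eq_zero : ∀ t : Fin 3 → Fin 3, ¬ Function.Injective t → levi t = 0 := by
  decide +kernel

/-- The sign character of `ZMod 2`, with integer values. -/
def intSign (a : ZMod 2) : ℤ := if a = 0 then 1 else -1

/-- The indicator of the edges whose colour is not `2`. -/
def notTwo (i : Fin 3) : ZMod 2 := if i = 2 then 0 else 1

/-- The local sign of a half-edge of colour `i` that lies next to a face of colour `a`. -/
def halfEdgeSign (i : Fin 3) (a : ZMod 2) : ℤ := if i = 0 then 1 else intSign a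

/-- Two of the three edges at a vertex avoid colour 2, so these edges form a cycle modulo 2. -/
lemma sum_notTwo : ∀ t : Fin 3 → Fin 3, Function.Injective t → ∑ k, notTwo (t k) = 0 := by
  decide +kernel

/-- The face colour changes across colours 0 and 1 only. Hence the half-edges of colours 1 and 2 see
different or equal face colours according to the cyclic order of the three colours. -/
lemma prod_halfEdgeSign_vertex : ∀ (t : Fin 3 → Fin 3) (a : Fin 3 → ZMod 2),
    Function.Injective t → (∀ k, a (k + 1) = a k + notTwo (t k)) →
      ∏ k, halfEdgeSign (t k) (a k) = - levi t := by
  decide +kernel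

/-- Colour 1 separates faces of different colours and gives `-1`; colour 2 lies between faces of
equal colour, and colour 0 carries no sign. -/
lemma prod_halfEdgeSign_edge : ∀ (i : Fin 3) (a b : ZMod 2), a + b = notTwo i →
    halfEdgeSign i a * halfEdgeSign i b = pauliSign i := by
  decide

/-! ### Evaluation of the state sum by 3-edge-colourings. -/

namespace RibbonGraph

variable {V D : Type*} {Γ : RibbonGraph V D}

/-- The colours of the two strands of a half-edge, if the colours of the left and of the right
strand of the first half of each edge are given by `Y`. -/
def strandColor {E : Type*} (ψ : E × Bool ≃ D) (Y : E → Bool → ZMod 2) (d : D) (s : Bool) :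
    ZMod 2 := Y (ψ.symm d).1 (xor (ψ.symm d).2 s)

/-- The definition of `strandColor` already accounts for the middle arcs, so only the corner arcs
impose conditions. -/
lemma compatible_strandColor_iff {E : Type*} {ψ : E × Bool ≃ D}
    (hopp : ∀ e b, Γ.opp (ψ (e, b)) = ψ (e, !b)) {φ : V × Fin 3 ≃ D}
    (hφ : ∀ v k, Γ.vert (φ (v, k)) = v) (hrot : ∀ v k, Γ.rot (φ (v, k)) = φ (v, k + 1))
    (Y : E → Bool → ZMod 2) (ν : V → Bool) :
    Γ.Compatible (Γ.vertexSmoothing ν) (fun p => strandColor ψ Y p.1 p.2) ↔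
      ∀ v k, strandColor ψ Y (φ (v, k)) (!ν v) = strandColor ψ Y (φ (v, k + 1)) (ν v) := by
  constructor
  · intro h v k
    have := h _ _ (Arc.corner (φ (v, k)))
    simpa [vertexSmoothing, hrot, hφ] using this
  · rintro h p q (⟨d, s⟩ | d)
    · obtain ⟨⟨e, b⟩, rfl⟩ := ψ.surjective d
      simp [strandColor, hopp]
    · obtain ⟨⟨v, k⟩, rfl⟩ := φ.surjective d
      have := h v k
      simpa [vertexSmoothing, hrot, hφ] using this

/-- A colouring of the circles of a state, in terms of the colours of the strands. -/
lemma card_circle_coloring {E : Type*} [Fintype E] [DecidableEq E] [Fintype V] [Finite D]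
    {ψ : E × Bool ≃ D}
    (hopp : ∀ e b, Γ.opp (ψ (e, b)) = ψ (e, !b)) {φ : V × Fin 3 ≃ D}
    (hφ : ∀ v k, Γ.vert (φ (v, k)) = v) (hrot : ∀ v k, Γ.rot (φ (v, k)) = φ (v, k + 1))
    (ν : V → Bool) :
    (2 : ℤ) ^ Nat.card (Γ.Circle (Γ.vertexSmoothing ν)) =
      ∑ Y : E → Bool → ZMod 2, ∏ v,
        if ∀ k, strandColor ψ Y (φ (v, k)) (!ν v) = strandColor ψ Y (φ (v, k + 1)) (ν v)
          then 1 else 0 := by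
  let P : (E → Bool → ZMod 2) → Prop := fun Y =>
    ∀ v k, strandColor ψ Y (φ (v, k)) (!ν v) = strandColor ψ Y (φ (v, k + 1)) (ν v)
  have hcomp := fun Y => compatible_strandColor_iff (Γ := Γ) hopp hφ hrot Y ν
  let e : {Y : E → Bool → ZMod 2 // P Y} ≃
      {X : Γ.SidePoint → ZMod 2 // Γ.Compatible (Γ.vertexSmoothing ν) X} :=
    { toFun := fun Y => ⟨fun p => strandColor ψ Y.1 p.1 p.2, (hcomp Y.1).2 Y.2⟩
      invFun := fun X => ⟨fun e s => X.1 (ψ (e, false), s), by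
        refine (hcomp _).1 ?_
        convert X.2 using 1
        funext ⟨d, s⟩
        obtain ⟨⟨e, b⟩, rfl⟩ := ψ.surjective d
        simp only [strandColor, Equiv.symm_apply_apply]
        cases b
        · simp
        · rw [X.2 _ _ (Arc.middle (ψ (e, true)) s), hopp]
          simp⟩
      left_inv := fun Y => by
        refine Subtype.ext (funext fun e => funext fun s => ?_)
        simp [strandColor]
      right_inv := fun X => by
        refine Subtype.ext (funext fun ⟨d, s⟩ => ?_)
        obtain ⟨⟨e, b⟩, rfl⟩ := ψ.surjective d
        simp only [strandColor, Equiv.symm_apply_apply]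
        cases b
        · simp
        · rw [X.2 _ _ (Arc.middle (ψ (e, true)) s), hopp]
          simp }
  have h1 : (2 : ℕ) ^ Nat.card (Γ.Circle (Γ.vertexSmoothing ν)) =
      Nat.card {Y : E → Bool → ZMod 2 // P Y} := by
    rw [Nat.card_congr (e.trans (circleColoringEquiv Γ _ (ZMod 2)).symm), Nat.card_fun,
      Nat.card_zmod]
  have h2 : (2 : ℤ) ^ Nat.card (Γ.Circle (Γ.vertexSmoothing ν)) =
      ((Nat.card {Y : E → Bool → ZMod 2 // P Y} : ℕ) : ℤ) := by
    rw [← h1]; norm_num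
  rw [h2, Nat.card_eq_fintype_card, Fintype.card_subtype, Finset.card_filter]
  push_cast
  refine Finset.sum_congr rfl fun Y _ => ?_
  rw [Finset.prod_ite_zero]
  simp [P]

/-- The Euler characteristic of the complex, as a state sum over the colours of the strands. -/
lemma sum_vertexStates {E : Type*} [Fintype E] [DecidableEq E] [Fintype V] [DecidableEq V]
    [Finite D] {ψ : E × Bool ≃ D}
    (hopp : ∀ e b, Γ.opp (ψ (e, b)) = ψ (e, !b)) {φ : V × Fin 3 ≃ D}
    (hφ : ∀ v k, Γ.vert (φ (v, k)) = v) (hrot : ∀ v k, Γ.rot (φ (v, k)) = φ (v, k + 1)) :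
    ∑ ν : V → Bool, (-1 : ℤ) ^ weight ν * 2 ^ Nat.card (Γ.Circle (Γ.vertexSmoothing ν)) =
      ∑ Y : E → Bool → ZMod 2, ∏ v, vertexWeight fun k => strandColor ψ Y (φ (v, k)) := by
  have hsign : ∀ ν : V → Bool, (-1 : ℤ) ^ weight ν = ∏ v, if ν v = true then -1 else 1 := by
    intro ν
    rw [Finset.prod_ite]
    simp [weight]
  simp only [card_circle_coloring hopp hφ hrot, hsign, Finset.mul_sum, ← Finset.prod_mul_distrib]
  rw [Finset.sum_comm]
  refine Finset.sum_congr rfl fun Y _ => ?_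
  -- The colouring `Y` does not refer to `ν`, and sign and indicator are products over vertices, so
  -- the sum over `ν` factors vertex by vertex.
  rw [← Fintype.prod_sum (fun v (b : Bool) => (if b = true then (-1 : ℤ) else 1) *
    if ∀ k, strandColor ψ Y (φ (v, k)) (!b) = strandColor ψ Y (φ (v, k + 1)) b then 1 else 0)]
  refine Finset.prod_congr rfl fun v _ => ?_
  rw [Fintype.sum_bool]
  simp only [vertexWeight, if_true, Bool.not_true, Bool.not_false, Bool.false_eq_true, if_false]
  ring

/-- The state sum after the change of basis to Pauli matrices, as a sum over the colourings of the
half-edges. -/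
lemma sum_prod_vertexWeight {E : Type*} [Fintype E] [DecidableEq E] [Fintype V] [DecidableEq V]
    [Fintype D] [DecidableEq D] (ψ : E × Bool ≃ D) (φ : V × Fin 3 ≃ D) :
    2 ^ Fintype.card V *
        ∑ Y : E → Bool → ZMod 2, ∏ v, vertexWeight (fun k => strandColor ψ Y (φ (v, k))) =
      ∑ c : D → Fin 3, (∏ v, levi fun k => c (φ (v, k))) *
        ∏ e, if c (ψ (e, false)) = c (ψ (e, true)) then 2 * pauliSign (c (ψ (e, false)))
          else 0 := by
  have h1 : ∀ Y : E → Bool → ZMod 2,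
      2 ^ Fintype.card V * ∏ v, vertexWeight (fun k => strandColor ψ Y (φ (v, k))) =
      ∑ c : D → Fin 3, (∏ v, levi fun k => c (φ (v, k))) *
        ∏ e, (pauli (Y e) (c (ψ (e, false))) * pauli (fun s => Y e (!s)) (c (ψ (e, true)))) := by
    intro Y
    rw [← Finset.card_univ, ← Finset.prod_const, ← Finset.prod_mul_distrib]
    simp only [two_mul_vertexWeight]
    rw [Fintype.prod_sum (fun v (t : Fin 3 → Fin 3) =>
      levi t * ∏ k, pauli (strandColor ψ Y (φ (v, k))) (t k))]
    -- A triple of Pauli indices at every vertex is the same as a colouring of the half-edges.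
    rw [← ((Equiv.arrowCongr φ.symm (Equiv.refl (Fin 3))).trans
      (Equiv.curry V (Fin 3) (Fin 3))).sum_comp]
    refine Finset.sum_congr rfl fun c _ => ?_
    rw [Finset.prod_mul_distrib]
    congr 1
    have h2 : ∏ d, pauli (strandColor ψ Y d) (c d) =
        ∏ v, ∏ k, pauli (strandColor ψ Y (φ (v, k))) (c (φ (v, k))) := by
      rw [← φ.prod_comp, Fintype.prod_prod_type]
    have h3 : ∏ d, pauli (strandColor ψ Y d) (c d) =
        ∏ e, (pauli (Y e) (c (ψ (e, false))) * pauli (fun s => Y e (!s)) (c (ψ (e, true)))) := by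
      rw [← ψ.prod_comp, Fintype.prod_prod_type]
      refine Finset.prod_congr rfl fun e _ => ?_
      rw [Fintype.prod_bool, mul_comm]
      congr 2 <;> funext s <;> simp [strandColor]
    rw [← h3, h2]
    rfl
  rw [Finset.mul_sum]
  simp only [h1]
  rw [Finset.sum_comm]
  refine Finset.sum_congr rfl fun c _ => ?_
  rw [← Finset.mul_sum, ← Fintype.prod_sum (fun e (x : Bool → ZMod 2) =>
    pauli x (c (ψ (e, false))) * pauli (fun s => x (!s)) (c (ψ (e, true))))]
  simp only [sum_pauli_mul_pauli]

/-- In a plane graph, all 3-edge-colourings have the same sign. -/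
lemma IsPlane.prod_levi_mul_prod_pauliSign [Fintype V] [Fintype D] [Fintype Γ.Edge]
    (hplane : Γ.IsPlane) (hV : Even (Fintype.card V)) {ψ : Γ.Edge × Bool ≃ D}
    (hψ : ∀ e b, Γ.edge (ψ (e, b)) = e)
    (hopp : ∀ e b, Γ.opp (ψ (e, b)) = ψ (e, !b)) {φ : V × Fin 3 ≃ D}
    (hφ : ∀ v k, Γ.vert (φ (v, k)) = v) (hrot : ∀ v k, Γ.rot (φ (v, k)) = φ (v, k + 1))
    (c : Γ.Edge → Fin 3) (hc : ∀ v, Function.Injective fun k => c (Γ.edge (φ (v, k)))) :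
    (∏ v, levi fun k => c (Γ.edge (φ (v, k)))) * ∏ e, pauliSign (c e) = 1 := by
  obtain ⟨g, hg1, hg2⟩ := hplane.exists_face_coloring φ hφ hrot (fun e => notTwo (c e))
    fun v => sum_notTwo _ (hc v)
  have hgrot : ∀ d, g (Γ.rot d) = g d + notTwo (c (Γ.edge d)) := by
    intro d
    have h1 := hg1 (Γ.opp d)
    rw [Γ.opp_opp] at h1
    rw [h1, ← hg2, ← add_assoc, CharTwo.add_self_eq_zero, zero_add]
  -- One product over the half-edges is evaluated by vertices and by edges; the factors `-1` from
  -- the vertices cancel because `|V|` is even.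
  have hv : ∏ d, halfEdgeSign (c (Γ.edge d)) (g d) =
      ∏ v, levi fun k => c (Γ.edge (φ (v, k))) := by
    rw [← φ.prod_comp, Fintype.prod_prod_type]
    have h1 : ∀ v, ∏ k, halfEdgeSign (c (Γ.edge (φ (v, k)))) (g (φ (v, k))) =
        - levi fun k => c (Γ.edge (φ (v, k))) := fun v =>
      prod_halfEdgeSign_vertex (fun k => c (Γ.edge (φ (v, k)))) (fun k => g (φ (v, k))) (hc v)
        fun k => by rw [← hrot, hgrot]
    simp only [h1]
    rw [Finset.prod_neg, Finset.card_univ, hV.neg_one_pow, one_mul]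
  have he : ∏ d, halfEdgeSign (c (Γ.edge d)) (g d) = ∏ e, pauliSign (c e) := by
    rw [← ψ.prod_comp, Fintype.prod_prod_type]
    refine Finset.prod_congr rfl fun e _ => ?_
    rw [Fintype.prod_bool, hψ, hψ]
    refine prod_halfEdgeSign_edge _ _ _ ?_
    have := hg2 (ψ (e, true))
    rwa [hopp, hψ] at this
  rw [← hv, he, ← Finset.prod_mul_distrib]
  simp only [pauliSign_mul_self, Finset.prod_const_one]

/-- A 3-edge-colouring, as a colouring of the half-edges. -/
def threeEdgeColoringEquiv {ψ : Γ.Edge × Bool ≃ D} (hψ : ∀ e b, Γ.edge (ψ (e, b)) = e)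
    {φ : V × Fin 3 ≃ D} (hφ : ∀ v k, Γ.vert (φ (v, k)) = v) :
    Γ.ThreeEdgeColoring ≃ {c : D → Fin 3 // (∀ e, c (ψ (e, false)) = c (ψ (e, true))) ∧
      ∀ v, Function.Injective fun k => c (φ (v, k))} where
  toFun c := ⟨fun d => c.1 (Γ.edge d), fun e => by simp only [hψ], fun v k l h => by
    by_contra hkl
    refine c.2 (φ (v, k)) (φ (v, l)) (fun h1 => hkl ?_) (by rw [hφ, hφ]) h
    simpa using h1⟩
  invFun c := ⟨fun e => c.1 (ψ (e, false)), fun d d' hd hv h => by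
    have key : ∀ d, c.1 (ψ (Γ.edge d, false)) = c.1 d := by
      intro d
      obtain ⟨⟨e, b⟩, rfl⟩ := ψ.surjective d
      rw [hψ]
      cases b
      · rfl
      · exact c.2.1 e
    simp only [key] at h
    obtain ⟨⟨v, k⟩, rfl⟩ := φ.surjective d
    obtain ⟨⟨w, l⟩, rfl⟩ := φ.surjective d'
    rw [hφ, hφ] at hv
    subst hv
    exact hd (by rw [c.2.2 v h])⟩
  left_inv c := by
    refine Subtype.ext (funext fun e => ?_)
    simp only [hψ]
  right_inv c := by
    refine Subtype.ext (funext fun d => ?_)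
    obtain ⟨⟨e, b⟩, rfl⟩ := ψ.surjective d
    simp only [hψ]
    cases b
    · rfl
    · exact c.2.1 e

/-- The evaluation of the state sum of a plane trivalent graph by 3-edge-colourings. -/
theorem IsPlane.sum_vertexStates_eq [Fintype V] [DecidableEq V] [Fintype D] [DecidableEq D]
    (htri : Γ.IsTrivalent) (hplane : Γ.IsPlane) :
    ∑ ν : V → Bool, (-1 : ℤ) ^ weight ν * 2 ^ Nat.card (Γ.Circle (Γ.vertexSmoothing ν)) =
      2 ^ (Fintype.card V / 2) * (Nat.card Γ.ThreeEdgeColoring : ℤ) := by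
  classical
  obtain ⟨ψ, hψ, hopp⟩ := Γ.exists_edge_equiv
  obtain ⟨φ, hφ, hrot⟩ := Γ.exists_vertex_equiv htri
  let _ : Fintype Γ.Edge := Fintype.ofFinite _
  -- Counting half-edges twice shows that `|V|` is even, so the division by 2 in the exponent is
  -- exact.
  have hcard : Fintype.card V * 3 = Fintype.card Γ.Edge * 2 := by
    have h1 := Fintype.card_congr (φ.trans ψ.symm)
    simpa [Fintype.card_prod] using h1
  obtain ⟨m, hm⟩ : ∃ m, Fintype.card V = 2 * m := ⟨Fintype.card V / 2, by omega⟩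
  have hE : Fintype.card Γ.Edge = 3 * m := by omega
  have hterm : ∀ c : D → Fin 3, (∏ v, levi fun k => c (φ (v, k))) *
        (∏ e, if c (ψ (e, false)) = c (ψ (e, true)) then 2 * pauliSign (c (ψ (e, false)))
          else 0) =
      if (∀ e, c (ψ (e, false)) = c (ψ (e, true))) ∧
        ∀ v, Function.Injective fun k => c (φ (v, k)) then 2 ^ (3 * m) else 0 := by
    intro c
    by_cases h1 : ∀ e, c (ψ (e, false)) = c (ψ (e, true))
    swap
    · rw [if_neg fun h => h1 h.1]
      push Not at h1
      obtain ⟨e, he⟩ := h1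
      rw [Finset.prod_eq_zero (Finset.mem_univ e) (if_neg he), mul_zero]
    by_cases h2 : ∀ v, Function.Injective fun k => c (φ (v, k))
    swap
    · rw [if_neg fun h => h2 h.2]
      push Not at h2
      obtain ⟨v, hv⟩ := h2
      rw [Finset.prod_eq_zero (Finset.mem_univ v) (levi_eq_zero _ hv), zero_mul]
    rw [if_pos ⟨h1, h2⟩]
    have hce : ∀ d, c (ψ (Γ.edge d, false)) = c d := by
      intro d
      obtain ⟨⟨e, b⟩, rfl⟩ := ψ.surjective d
      rw [hψ]
      cases b
      · rfl
      · exact h1 e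
    have := hplane.prod_levi_mul_prod_pauliSign ⟨m, by omega⟩ hψ hopp hφ hrot
      (fun e => c (ψ (e, false))) (fun v => by simpa only [hce] using h2 v)
    simp only [hce] at this
    simp only [h1, if_true] at this ⊢
    rw [Finset.prod_mul_distrib, Finset.prod_const, Finset.card_univ, hE]
    linear_combination 2 ^ (3 * m) * this
  have hmain := sum_prod_vertexWeight ψ φ
  rw [← sum_vertexStates hopp hφ hrot] at hmain
  simp only [hterm] at hmain
  rw [← Finset.sum_filter, Finset.sum_const, ← Fintype.card_subtype,
    ← Fintype.card_congr (threeEdgeColoringEquiv hψ hφ), hm, ← Nat.card_eq_fintype_card,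
    nsmul_eq_mul] at hmain
  rw [hm, Nat.mul_div_cancel_left m (by norm_num)]
  -- It remains to cancel `2^|V| = 2^(2m)` from `2^|E| = 2^(3m)`.
  have hpos : (2 : ℤ) ^ (2 * m) ≠ 0 := by positivity
  refine mul_left_cancel₀ hpos (hmain.trans ?_)
  rw [mul_comm, ← mul_assoc, ← pow_add]
  congr 2
  ring

end RibbonGraph

theorem theorem3 {V D : Type*} [Fintype V] [LinearOrder V] [Fintype D] [DecidableEq D]
    (Γ : RibbonGraph V D) (htri : Γ.IsTrivalent) (hplane : Γ.IsPlane) (path : Γ.PathChoice) :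
    (∀ i : ℕ, Γ.differential 2 path (i + 1) ∘ₗ Γ.differential 2 path i = 0) ∧
    Γ.filteredEulerChar 2 path =
      2 ^ (Fintype.card V / 2) * (Nat.card Γ.ThreeEdgeColoring : ℤ) :=
  ⟨RibbonGraph.differential_comp_differential path, by
    rw [RibbonGraph.filteredEulerChar_eq, hplane.sum_vertexStates_eq htri]⟩
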